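/- Let $K$ be a field of characteristic $0$ and $X$ a set of variables. Let $\mathrm{Mag}$ (resp. $\mathrm{Mag}_\omega$) be the $K$-linear operad freely generated by one non-symmetric operation $\vee^2$ (resp. by one non-symmetric operation $\vee^k$ for each $k\ge 2$). Let $A=K\{X\}$ (resp. $A=K\{X\}_\infty$) be the free unitary $\mathrm{Mag}$- (resp. $\mathrm{Mag}_\omega$-) algebra on $X$. Its basis of monomials consists of the empty tree $1$ and all planar binary (resp. planar reduced, i.e. every internal vertex has at least two incoming edges) rooted trees with leaves labelled by $X$; $\vee^k$ grafts $k$ trees onto a new root, where empty trees are omitted, so that $\vee^k(\dots,1,\dots)=\vee^{k-1}(\dots)$, $\vee^2(1,a)=\vee^2(a,1)=a$ and $\vee^k(1,\dots,1)=1$. $A=\bigoplus_n A^{(n)}$ is graded by the number of leaves. The co-addition $\Delta_a:A\to A\otimes A$ is the homomorphism of unitary $\mathrm{Mag}$- (resp. $\mathrm{Mag}_\omega$-) algebras with $\Delta_a(x)=x\otimes 1+1\otimes x$ for $x\in X$, where the operations on $A\otimes A$ are defined componentwise. Put $\mathrm{Prim}\,A=\{f\in A:\Delta_a(f)=f\otimes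 1+1\otimes f\}$ and $\mathrm{Prim}\,A^{(n)}=\mathrm{Prim}\,A\cap A^{(n)}$. Let $\langle\ ,\ \rangle$ be the bilinear form on $A$ for which the monomials are orthonormal, and let the shuffle product $\sqcup\!\sqcup$ be the multiplication of the graded dual of $(A,\Delta_a)$, transported to $A$ by the monomial basis: $\langle f \sqcup\!\sqcup g,h\rangle=\langle f\otimes g,\Delta_a(h)\rangle$ for all $f,g,h\in A$. Then $\mathrm{Prim}\,A=\bigoplus_n\mathrm{Prim}\,A^{(n)}$, and: (i) $(A,\sqcup\!\sqcup)$ is a unitary commutative associative algebra with unit $1$, freely generated by $\mathrm{Prim}\,A$; that is, the inclusion of $\mathrm{Prim}\,A$ extends to an isomorphism from the symmetric algebra on $\mathrm{Prim}\,A$ onto $(A,\sqcup\!\sqcup)$. (ii) For $\mathcal P=\mathrm{Mag}$ and for $\mathcal P=\mathrm{Mag}_\omega$, let $\mathcal P(n)$ be the space of $n$-ary operations of $\mathcal P$ (spanned by the planar binary, resp. planar reduced, trees with leaves labelled bijectively by $x_1,\dots,x_n$), and let $(\mathrm{Prim}\,\mathcal P)(n)\subseteq\mathcal P(n)$ be the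 subspace of the operations whose value on the generators $x_1,\dots,x_n$ of the free unitary $\mathcal P$-algebra is primitive. All these spaces are finite-dimensional, and the generating series $f^{\mathcal P}(t)=\sum_{n\ge1}\frac{\dim\mathcal P(n)}{n!}t^n$ and $f^{\mathrm{Prim}\,\mathcal P}(t)=\sum_{n\ge1}\frac{\dim(\mathrm{Prim}\,\mathcal P)(n)}{n!}t^n$ satisfy $$f^{\mathrm{Prim}\,\mathcal P}(t)=\log\bigl(1+f^{\mathcal P}(t)\bigr)\quad\text{in }\mathbb Q[[t]].$$ (iii) Let $n\ge2$, and let $B^{(n)}$ be the orthogonal complement of $\mathrm{Prim}\,A^{(n)}$ in $A^{(n)}$ with respect to $\langle\ ,\ \rangle$. If $(f_i)_{i\in I}$, with $I$ totally ordered, is a basis of $\bigoplus_{k=1}^{n-1}\mathrm{Prim}\,A^{(k)}$ consisting of homogeneous elements, then the elements $f_{i_1} \sqcup\!\sqcup f_{i_2} \sqcup\!\sqcup \cdots \sqcup\!\sqcup f_{i_k}$ with $i_1\le i_2\le\dots\le i_k$ and $\sum_{j=1}^k\deg f_{i_j}=n$ form a basis of $B^{(n)}$. -/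

import Mathlib

open scoped TensorProduct

noncomputable section

namespace MagPBW

universe u v

/-! ## Operads, reduced planar trees, monomials -/

/-- The two operads under consideration: `Mag`, freely generated by one binary operation `∨²`, and
`MagOmega`, freely generated by one operation `∨ᵏ` of every arity `k ≥ 2`. -/
inductive Kind : Type
  | Mag
  | MagOmega

/-- The arities of the generating operations `∨ᵏ`. -/
def Kind.Arity : Kind → ℕ → Prop
  | .Mag, k => k = 2
  | .MagOmega, k => 2 ≤ k

theorem Kind.Arity.mono {P : Kind} {j k : ℕ} (hk : P.Arity k) (hj : 2 ≤ j) (hjk : j ≤ k) :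
    P.Arity j := by
  cases P
  · simp only [Kind.Arity] at *; omega
  · exact hj

theorem Kind.Arity.two_le {P : Kind} {k : ℕ} (hk : P.Arity k) : 2 ≤ k := by
  cases P
  · simp only [Kind.Arity] at *; omega
  · exact hk

/-- Nonempty reduced planar rooted trees whose leaves are labelled by `X`. For `MagOmega` every
internal vertex has at least two incoming edges, for `Mag` exactly two (planar binary trees). -/
inductive PRTree (P : Kind) (X : Type u) : Type u
  | leaf (x : X) : PRTree P X
  | node (k : ℕ) (hk : P.Arity k) (c : Fin k → PRTree P X) : PRTree P X

/-- Monomials: reduced planar trees, together with the empty tree `none`, which is the unit `1`. -/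
abbrev Monomial (P : Kind) (X : Type u) : Type u := Option (PRTree P X)

variable {P : Kind} {X : Type u}

/-- The multiset of leaf labels of a tree. -/
def PRTree.content : PRTree P X → Multiset X
  | .leaf x => {x}
  | .node _ _ c => ∑ i, (c i).content

/-- The multiset of leaf labels of a monomial. -/
def Monomial.content : Monomial P X → Multiset X
  | none => 0
  | some T => T.content

/-- The degree of a monomial is its number of leaves. -/
def Monomial.degree (m : Monomial P X) : ℕ := Multiset.card m.content

open Classical in
/-- Grafting a list of nonempty trees onto a new root, with the conventions `∨() = 1` and
`∨(T) = T`. (If `k` is an arity of a generating operation and `2 ≤ l.length ≤ k`, then `l.length`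
is such an arity too, so the last alternative is never met in the operations below.) -/
def graft : List (PRTree P X) → Monomial P X
  | [] => none
  | [T] => some T
  | T :: T' :: l =>
      if h : P.Arity (T :: T' :: l).length then some (.node _ h (T :: T' :: l).get) else none

/-- The operation `∨ᵏ` on monomials, with the unit action
`∨ᵏ(T₁, …, 1, …, Tₖ) = ∨ᵏ⁻¹(T₁, …, Tₖ)`, `∨²(1, T) = ∨²(T, 1) = T`, `∨ᵏ(1, …, 1) = 1`:
the empty trees among the arguments are dropped and the remaining trees are grafted. -/
def veeMon (k : ℕ) (m : Fin k → Monomial P X) : Monomial P X :=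
  graft (List.ofFn m).reduceOption

variable (K : Type v) [Field K]

open Classical in
/-- The multilinear extension of an operation `op` on bases. -/
def multiExtend {N N' : Type*} {k : ℕ} (op : (Fin k → N) → N') :
    MultilinearMap K (fun _ : Fin k => N →₀ K) (N' →₀ K) :=
  (Finsupp.lmapDomain K K op ∘ₗ
    (PiTensorProduct.ofFinsuppEquiv' :
      (PiTensorProduct K fun _ : Fin k => N →₀ K) ≃ₗ[K] ((Fin k → N) →₀ K)).toLinearMap)
    |>.compMultilinearMap (PiTensorProduct.tprod K)

theorem multiExtend_single {N N' : Type*} {k : ℕ} (op : (Fin k → N) → N')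
    (p : Fin k → N) (r : Fin k → K) :
    multiExtend K op (fun i => Finsupp.single (p i) (r i)) = Finsupp.single (op p) (∏ i, r i) := by
  classical
  simp only [multiExtend, LinearMap.compMultilinearMap_apply, LinearMap.comp_apply,
    LinearEquiv.coe_coe]
  convert congrArg (Finsupp.lmapDomain K K op)
    (PiTensorProduct.ofFinsuppEquiv'_tprod_single (R := K) p r) using 1
  simp

variable (P X)

/-- The underlying vector space of the free unitary algebra on `X`: `K{X}` for `Mag` and `K{X}_∞`
for `MagOmega`. The monomials form a basis. -/
abbrev FreeAlg : Type max u v := Monomial P X →₀ K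

variable {P X}

/-- A monomial as an element of the free unitary algebra. -/
abbrev mon (m : Monomial P X) : FreeAlg P X K := Finsupp.single m 1

/-- The unit `1`, i.e. the empty tree. -/
abbrev unit : FreeAlg P X K := mon K none

/-- The multilinear operation `∨ᵏ` on the free unitary algebra. -/
def vee (k : ℕ) : MultilinearMap K (fun _ : Fin k => FreeAlg P X K) (FreeAlg P X K) :=
  multiExtend K (veeMon k)

variable (P X) in
/-- Coordinates on `A ⊗ A` with respect to the basis of the `S ⊗ S'`, for monomials `S`, `S'`. -/
abbrev tensorCoord : (FreeAlg P X K ⊗[K] FreeAlg P X K) ≃ₗ[K]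
    (Monomial P X × Monomial P X →₀ K) :=
  finsuppTensorFinsupp' K _ _

/-- The operation `∨ᵏ` on `A ⊗ A`, i.e. the multilinear map with
`∨ᵏ(a₁ ⊗ b₁, …, aₖ ⊗ bₖ) = ∨ᵏ(a₁, …, aₖ) ⊗ ∨ᵏ(b₁, …, bₖ)`. -/
def veeTensor (k : ℕ) :
    MultilinearMap K (fun _ : Fin k => FreeAlg P X K ⊗[K] FreeAlg P X K)
      (FreeAlg P X K ⊗[K] FreeAlg P X K) :=
  (tensorCoord P X K).symm.toLinearMap.compMultilinearMap
    ((multiExtend K fun m => (veeMon k fun i => (m i).1, veeMon k fun i => (m i).2)).compLinearMap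
      fun _ => (tensorCoord P X K).toLinearMap)

/-! ## The co-addition -/

/-- The co-addition on nonempty trees: `x ↦ x ⊗ 1 + 1 ⊗ x` on leaves, and compatible with the
operations `∨ᵏ`. -/
def coaddTree : PRTree P X → FreeAlg P X K ⊗[K] FreeAlg P X K
  | .leaf x => mon K (some (.leaf x)) ⊗ₜ[K] unit K + unit K ⊗ₜ[K] mon K (some (.leaf x))
  | .node k _ c => veeTensor K k fun i => coaddTree (c i)

/-- The co-addition on monomials. -/
def coaddMon : Monomial P X → FreeAlg P X K ⊗[K] FreeAlg P X K
  | none => unit K ⊗ₜ[K] unit K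
  | some T => coaddTree K T

variable (P X) in
/-- The co-addition `Δₐ : A → A ⊗ A`: the homomorphism of unitary algebras with
`x ↦ x ⊗ 1 + 1 ⊗ x` for `x ∈ X`. -/
def coadd : FreeAlg P X K →ₗ[K] FreeAlg P X K ⊗[K] FreeAlg P X K :=
  Finsupp.linearCombination K (coaddMon K)

theorem tensorCoord_symm_single (n : Monomial P X × Monomial P X) (c : K) :
    (tensorCoord P X K).symm (Finsupp.single n c) = c • (mon K n.1 ⊗ₜ[K] mon K n.2) := by
  rw [LinearEquiv.symm_apply_eq, map_smul, finsuppTensorFinsupp'_single_tmul_single]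
  simp

theorem veeTensor_tmul (k : ℕ) (a b : Fin k → FreeAlg P X K) :
    veeTensor K k (fun i => a i ⊗ₜ[K] b i) = vee K k a ⊗ₜ[K] vee K k b := by
  have h1 : ∀ p q : Fin k → Monomial P X,
      veeTensor K k (fun i => mon K (p i) ⊗ₜ[K] mon K (q i)) =
        vee K k (fun i => mon K (p i)) ⊗ₜ[K] vee K k (fun i => mon K (q i)) := by
    intro p q
    simp only [veeTensor, vee, LinearMap.compMultilinearMap_apply,
      MultilinearMap.compLinearMap_apply, LinearEquiv.coe_coe,
      finsuppTensorFinsupp'_single_tmul_single, mul_one]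
    rw [multiExtend_single K _ (fun i => (p i, q i)), multiExtend_single, multiExtend_single,
      tensorCoord_symm_single]
    simp
  have h2 : ∀ (p : Fin k → Monomial P X) (b : Fin k → FreeAlg P X K),
      veeTensor K k (fun i => mon K (p i) ⊗ₜ[K] b i) =
        vee K k (fun i => mon K (p i)) ⊗ₜ[K] vee K k b := by
    intro p b
    have : (veeTensor K k).compLinearMap
          (fun i => TensorProduct.mk K (FreeAlg P X K) (FreeAlg P X K) (mon K (p i))) =
        (TensorProduct.mk K (FreeAlg P X K) (FreeAlg P X K)
          (vee K k (fun i => mon K (p i)))).compMultilinearMap (vee K k) :=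
      Module.Basis.ext_multilinear (fun _ => Finsupp.basisSingleOne) fun q => by
        simpa using h1 p q
    simpa using congrArg (fun f => f b) this
  have : (veeTensor K k).compLinearMap
        (fun i => (TensorProduct.mk K (FreeAlg P X K) (FreeAlg P X K)).flip (b i)) =
      ((TensorProduct.mk K (FreeAlg P X K) (FreeAlg P X K)).flip
        (vee K k b)).compMultilinearMap (vee K k) :=
    Module.Basis.ext_multilinear (fun _ => Finsupp.basisSingleOne) fun p => by
      simpa using h2 p b
  simpa using congrArg (fun f => f a) this

/-- Auxiliary: multilinear extension of an operation on words, evaluated letter by letter. -/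
def wordExtend {N N' : Type*} : (List N → N') → List (N →₀ K) → (N' →₀ K)
  | g, [] => Finsupp.single (g []) 1
  | g, t :: L => t.sum fun n c => c • wordExtend (fun l => g (n :: l)) L

theorem wordExtend_ofFn {N N' : Type*} {k : ℕ} (g : List N → N') (t : Fin k → N →₀ K) :
    multiExtend K (fun p : Fin k → N => g (List.ofFn p)) t = wordExtend K g (List.ofFn t) := by
  classical
  have hlin : ∀ (j : ℕ) (g : List N → N'), ∃ F : MultilinearMap K (fun _ : Fin j => N →₀ K)
      (N' →₀ K), ∀ t, F t = wordExtend K g (List.ofFn t) := by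
    intro j
    induction j with
    | zero => intro g; exact ⟨MultilinearMap.constOfIsEmpty K _ (Finsupp.single (g []) 1),
        fun t => by simp [wordExtend]⟩
    | succ j ih =>
      intro g
      choose F hF using fun n => ih (fun l => g (n :: l))
      refine ⟨LinearMap.uncurryLeft (Finsupp.lsum K fun n =>
        LinearMap.toSpanSingleton K _ (F n)), fun t => ?_⟩
      rw [List.ofFn_succ, wordExtend, LinearMap.uncurryLeft_apply, Finsupp.lsum_apply,
        Finsupp.sum, sum_apply, Finsupp.sum]
      refine Finset.sum_congr rfl fun n _ => ?_
      simp only [LinearMap.toSpanSingleton_apply, smul_apply, hF]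
      rfl
  obtain ⟨F, hF⟩ := hlin k g
  rw [← hF]
  congr 1
  refine Module.Basis.ext_multilinear (fun _ => Finsupp.basisSingleOne) fun p => ?_
  simp only [Finsupp.coe_basisSingleOne]
  rw [multiExtend_single, hF]
  simp only [Finset.prod_const_one]
  clear hF F t hlin
  induction k generalizing g with
  | zero => simp [wordExtend]
  | succ k ih =>
    rw [List.ofFn_succ, List.ofFn_succ, wordExtend, Finsupp.sum_single_index (by simp), one_smul]
    exact ih (fun l => g (p 0 :: l)) (fun i => p i.succ)

theorem wordExtend_reduceOption {N N' : Type*} (u : N) (d : PRTree P X → N →₀ K)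
    (g : List N → N') (hg : ∀ l l', g (l ++ u :: l') = g (l ++ l')) (L : List (Monomial P X)) :
    wordExtend K g (L.map fun m => m.elim (Finsupp.single u 1) d) =
      wordExtend K g (L.reduceOption.map d) := by
  induction L generalizing g with
  | nil => rfl
  | cons m L ih =>
    cases m with
    | none =>
      rw [List.map_cons, List.reduceOption_cons_of_none, wordExtend, Option.elim_none,
        Finsupp.sum_single_index (by simp), one_smul, ← ih g hg]
      congr 1
      funext l
      exact hg [] l
    | some T =>
      rw [List.map_cons, List.reduceOption_cons_of_some, List.map_cons, wordExtend, wordExtend]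
      refine Finsupp.sum_congr fun n _ => ?_
      rw [← ih (fun l => g (n :: l)) fun l l' => hg (n :: l) l']

/-- The co-addition is a homomorphism for the operations `∨ᵏ`. -/
theorem coadd_vee {k : ℕ} (hk : P.Arity k) (a : Fin k → FreeAlg P X K) :
    coadd P X K (vee K k a) = veeTensor K k fun i => coadd P X K (a i) := by
  set g : List (Monomial P X × Monomial P X) → Monomial P X × Monomial P X := fun l =>
    (graft (l.map Prod.fst).reduceOption, graft (l.map Prod.snd).reduceOption) with hgdef
  have hvee : ∀ (j : ℕ) (t : Fin j → FreeAlg P X K ⊗[K] FreeAlg P X K), veeTensor K j t =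
      (tensorCoord P X K).symm
        (wordExtend K g ((List.ofFn t).map fun s => tensorCoord P X K s)) := by
    intro j t
    rw [← List.ofFn_comp', ← wordExtend_ofFn]
    simp only [veeTensor, hgdef, veeMon, LinearMap.compMultilinearMap_apply,
      MultilinearMap.compLinearMap_apply, LinearEquiv.coe_coe, List.map_ofFn]
    rfl
  have hmon : ∀ p : Fin k → Monomial P X,
      coaddMon K (veeMon k p) = veeTensor K k fun i => coaddMon K (p i) := by
    intro p
    have hu : ∀ l l', g (l ++ (none, none) :: l') = g (l ++ l') := by
      intro l l'
      simp only [hgdef, List.map_append, List.map_cons, List.reduceOption_append,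
        List.reduceOption_cons_of_none]
    have e1 : (List.ofFn fun i => coaddMon K (p i)).map (fun s => tensorCoord P X K s) =
        (List.ofFn p).map fun m =>
          m.elim (Finsupp.single (none, none) 1) fun T => tensorCoord P X K (coaddTree K T) := by
      rw [List.map_ofFn, List.map_ofFn]
      congr 1
      funext i
      cases h : p i <;> simp [coaddMon, h]
    rw [hvee, e1, wordExtend_reduceOption K _ _ g hu, veeMon]
    have hl : (List.ofFn p).reduceOption.length ≤ k := by
      simpa using List.reduceOption_length_le (List.ofFn p)
    match (List.ofFn p).reduceOption, hl with
    | [], _ => simp [graft, coaddMon, wordExtend, hgdef, tensorCoord_symm_single]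
    | [T], _ =>
      have hg1 : ∀ n, g [n] = n := by
        rintro ⟨n, n'⟩
        cases n <;> cases n' <;> simp [hgdef, graft, List.reduceOption]
      simp [graft, coaddMon, wordExtend, hg1]
    | T :: T' :: l, hl =>
      have h : P.Arity (T :: T' :: l).length := hk.mono (by simp) hl
      rw [graft, dif_pos h, coaddMon, coaddTree, hvee, List.map_ofFn]
      congr 2
      conv_rhs => rw [← List.ofFn_get (T :: T' :: l)]
      rw [List.map_ofFn]
      rfl
  have : (coadd P X K).compMultilinearMap (vee K k) =
      (veeTensor K k).compLinearMap fun _ => coadd P X K :=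
    Module.Basis.ext_multilinear (fun _ => Finsupp.basisSingleOne) fun p => by
      simp only [Finsupp.coe_basisSingleOne, LinearMap.compMultilinearMap_apply,
        MultilinearMap.compLinearMap_apply, vee, multiExtend_single]
      simpa [coadd] using hmon p
  simpa using congrArg (fun f => f a) this

/-! ## Finiteness facts needed for the graded dual -/

theorem PRTree.content_card_pos (T : PRTree P X) : 0 < Multiset.card T.content := by
  induction T with
  | leaf x => simp [PRTree.content]
  | node k hk c ih =>
    have h2 := hk.two_le
    rw [PRTree.content, Multiset.card_sum]
    exact Finset.sum_pos (fun i _ => ih i) ⟨⟨0, by omega⟩, Finset.mem_univ _⟩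

theorem content_graft {k : ℕ} (hk : P.Arity k) (l : List (PRTree P X)) (hl : l.length ≤ k) :
    (graft l).content = (l.map PRTree.content).sum := by
  match l, hl with
  | [], _ => rfl
  | [T], _ => simp [graft, Monomial.content]
  | T :: T' :: l, hl =>
    have h : P.Arity (T :: T' :: l).length := hk.mono (by simp) hl
    rw [graft, dif_pos h, Monomial.content, PRTree.content]
    rw [← List.sum_ofFn, List.ofFn_comp' (T :: T' :: l).get PRTree.content, List.ofFn_get]

theorem content_reduceOption (l : List (Monomial P X)) :
    (l.reduceOption.map PRTree.content).sum = (l.map Monomial.content).sum := by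
  induction l with
  | nil => rfl
  | cons m l ih =>
    cases m with
    | none => simpa [List.reduceOption_cons_of_none, Monomial.content] using ih
    | some T => simp [List.reduceOption_cons_of_some, Monomial.content, ih]

theorem content_veeMon {k : ℕ} (hk : P.Arity k) (m : Fin k → Monomial P X) :
    (veeMon k m).content = ∑ i, (m i).content := by
  have hl : (List.ofFn m).reduceOption.length ≤ k := by
    simpa using List.reduceOption_length_le (List.ofFn m)
  rw [veeMon, content_graft hk _ hl, content_reduceOption, ← List.sum_ofFn,
    List.ofFn_comp' m Monomial.content]

theorem exists_of_multiExtend_ne_zero {N N' : Type*} {k : ℕ} (op : (Fin k → N) → N')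
    (t : Fin k → N →₀ K) (n : N') (h : multiExtend K op t n ≠ 0) :
    ∃ p : Fin k → N, op p = n ∧ ∀ i, t i (p i) ≠ 0 := by
  classical
  have h1 := Finsupp.mapDomain_support (Finsupp.mem_support_iff.mpr h)
  obtain ⟨p, hp, rfl⟩ := Finset.mem_image.mp h1
  refine ⟨p, rfl, fun i hi => ?_⟩
  rw [Finsupp.mem_support_iff] at hp
  apply hp
  have := PiTensorProduct.ofFinsuppEquiv'_apply_apply t p
  refine Eq.trans ?_ (this.trans (Finset.prod_eq_zero (Finset.mem_univ i) hi))
  congr!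

theorem content_of_coaddTree_ne_zero (T : PRTree P X) (S S' : Monomial P X)
    (h : tensorCoord P X K (coaddTree K T) (S, S') ≠ 0) :
    S.content + S'.content = T.content := by
  classical
  induction T generalizing S S' with
  | leaf x =>
    simp only [coaddTree, map_add, finsuppTensorFinsupp'_single_tmul_single, mul_one,
      Finsupp.add_apply, Finsupp.single_apply, Prod.mk.injEq] at h
    by_cases h1 : some (PRTree.leaf x) = S ∧ none = S'
    · obtain ⟨rfl, rfl⟩ := h1; simp [Monomial.content, PRTree.content]
    · by_cases h2 : none = S ∧ some (PRTree.leaf x) = S'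
      · obtain ⟨rfl, rfl⟩ := h2; simp [Monomial.content, PRTree.content]
      · simp [h1, h2] at h
  | node k hk c ih =>
    rw [coaddTree, veeTensor] at h
    simp only [LinearMap.compMultilinearMap_apply, MultilinearMap.compLinearMap_apply,
      LinearEquiv.coe_coe, LinearEquiv.apply_symm_apply] at h
    obtain ⟨p, hp, hne⟩ := exists_of_multiExtend_ne_zero K _ _ _ h
    simp only [Prod.mk.injEq] at hp
    obtain ⟨rfl, rfl⟩ := hp
    rw [content_veeMon hk, content_veeMon hk, ← Finset.sum_add_distrib, PRTree.content]
    exact Finset.sum_congr rfl fun i _ => ih i _ _ (hne i)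

theorem finite_trees_content (c : Multiset X) : {T : PRTree P X | T.content = c}.Finite := by
  classical
  induction hn : Multiset.card c using Nat.strong_induction_on generalizing c with
  | _ n ih =>
  subst hn
  set D : Set (PRTree P X) :=
    ⋃ d ∈ {d : Multiset X | d ∈ c.powerset ∧ Multiset.card d < Multiset.card c},
      {T : PRTree P X | T.content = d} with hD
  have hDfin : D.Finite := by
    refine Set.Finite.biUnion ?_ fun d hd => ih _ hd.2 d rfl
    exact (Multiset.finite_toSet c.powerset).subset fun d hd => hd.1
  have key : {T : PRTree P X | T.content = c} ⊆
      (PRTree.leaf '' {x | x ∈ c}) ∪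
      ⋃ k ∈ Set.Iic (Multiset.card c), ⋃ hk : P.Arity k,
        (PRTree.node k hk '' Set.pi Set.univ fun _ => D) := by
    intro T hT
    cases T with
    | leaf x =>
      left
      refine ⟨x, ?_, rfl⟩
      rw [Set.mem_ofPred_eq, ← show PRTree.content (P := P) (.leaf x) = c from hT]
      simp [PRTree.content]
    | node k hk f =>
      right
      have hT' : ∑ i, (f i).content = c := hT
      have hcard : ∑ i, Multiset.card (f i).content = Multiset.card c := by
        rw [← hT', Multiset.card_sum]
      have hkc : k ≤ Multiset.card c := by
        rw [← hcard]
        calc k = ∑ _i : Fin k, 1 := by simp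
          _ ≤ _ := Finset.sum_le_sum fun i _ => (f i).content_card_pos
      simp only [Set.mem_iUnion, Set.mem_Iic]
      refine ⟨k, hkc, hk, f, fun i _ => ?_, rfl⟩
      simp only [hD, Set.mem_iUnion]
      refine ⟨(f i).content, ⟨?_, ?_⟩, rfl⟩
      · rw [Multiset.mem_powerset, ← hT']
        exact Finset.single_le_sum (f := fun i => (f i).content) (fun _ _ => Multiset.zero_le _)
          (Finset.mem_univ i)
      · have h2 := hk.two_le
        obtain ⟨j, hj⟩ : ∃ j : Fin k, j ≠ i := by
          have : Nontrivial (Fin k) := Fin.nontrivial_iff_two_le.mpr h2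
          exact exists_ne i
        rw [← hcard]
        exact Finset.single_lt_sum (f := fun i => Multiset.card (f i).content) hj
          (Finset.mem_univ i) (Finset.mem_univ j) (f j).content_card_pos
          (fun _ _ _ => Nat.zero_le _)
  refine Set.Finite.subset (Set.Finite.union ?_ ?_) key
  · exact ((Multiset.finite_toSet c)).image _
  · refine Set.Finite.biUnion (Set.finite_Iic _) fun k _ => Set.finite_iUnion fun hk => ?_
    exact (Set.Finite.pi fun _ => hDfin).image _

theorem finite_coeff (S S' : Monomial P X) :
    (Function.support fun T : Monomial P X =>
      tensorCoord P X K (coadd P X K (mon K T)) (S, S')).Finite := by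
  refine (((finite_trees_content (P := P) (S.content + S'.content)).image some).union
    (Set.finite_singleton none)).subset fun T hT => ?_
  cases T with
  | none => right; rfl
  | some T =>
    left
    refine ⟨T, (content_of_coaddTree_ne_zero K T S S' ?_).symm, rfl⟩
    simpa [coadd, coaddMon] using hT

/-! ## The shuffle product, primitive elements, orthogonal complements -/

/-- The shuffle product of two monomials: the coefficient of `T` in `S ⧢ S'` is the coefficient of
`S ⊗ S'` in `Δₐ(T)`. -/
def shuffleMon (S S' : Monomial P X) : FreeAlg P X K :=
  Finsupp.ofSupportFinite
    (fun T => tensorCoord P X K (coadd P X K (mon K T)) (S, S')) (finite_coeff K S S')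

variable (P X) in
/-- The (planar tree) shuffle product on `A`, i.e. the multiplication of the graded dual of
`(A, Δₐ)`, where `A` is identified with its graded dual by means of the basis of monomials. -/
def shuffle : FreeAlg P X K →ₗ[K] FreeAlg P X K →ₗ[K] FreeAlg P X K :=
  Finsupp.linearCombination K fun S => Finsupp.linearCombination K fun S' => shuffleMon K S S'

variable (P X) in
/-- The bilinear form `⟨ , ⟩` on `A` for which the monomials are orthonormal. -/
def pairing : FreeAlg P X K →ₗ[K] FreeAlg P X K →ₗ[K] K :=
  Finsupp.linearCombination K fun S => Finsupp.lapply S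

/-- `⟨f ⧢ g, h⟩ = ⟨f ⊗ g, Δₐ(h)⟩`, where `⟨f ⊗ g, a ⊗ b⟩ = ⟨f, a⟩⟨g, b⟩`. -/
theorem pairing_shuffle (f g h : FreeAlg P X K) :
    pairing P X K (shuffle P X K f g) h =
      TensorProduct.lid K K
        (TensorProduct.map (pairing P X K f) (pairing P X K g) (coadd P X K h)) := by
  have hcoord : ∀ (S S' : Monomial P X) (t : FreeAlg P X K ⊗[K] FreeAlg P X K),
      TensorProduct.lid K K (TensorProduct.map (pairing P X K (mon K S)) (pairing P X K (mon K S')) t)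
        = tensorCoord P X K t (S, S') := by
    intro S S' t
    induction t using TensorProduct.induction_on with
    | zero => simp
    | add x y hx hy => simp only [map_add, hx, hy, Finsupp.add_apply]
    | tmul x y => simp [pairing]
  have hsym : ∀ (a : FreeAlg P X K) (T : Monomial P X), pairing P X K a (mon K T) = a T := by
    intro a T
    induction a using Finsupp.induction_linear with
    | zero => simp
    | add x y hx hy => rw [map_add, LinearMap.add_apply, hx, hy, Finsupp.add_apply]
    | single S c =>
      classical
      simp [pairing, Finsupp.single_apply, eq_comm]
  induction f using Finsupp.induction_linear with
  | zero => simp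
  | add x y hx hy => simp only [map_add, LinearMap.add_apply, TensorProduct.map_add_left, hx, hy]
  | single S c =>
  induction g using Finsupp.induction_linear with
  | zero => simp
  | add x y hx hy => simp only [map_add, LinearMap.add_apply, TensorProduct.map_add_right, hx, hy]
  | single S' c' =>
  induction h using Finsupp.induction_linear with
  | zero => simp
  | add x y hx hy => simp only [map_add, hx, hy]
  | single T d =>
    have e1 : (Finsupp.single S c : FreeAlg P X K) = c • mon K S := by simp
    have e2 : (Finsupp.single S' c' : FreeAlg P X K) = c' • mon K S' := by simp
    have e3 : (Finsupp.single T d : FreeAlg P X K) = d • mon K T := by simp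
    rw [e1, e2, e3]
    simp only [map_smul, LinearMap.smul_apply, TensorProduct.map_smul_left,
      TensorProduct.map_smul_right, hcoord, hsym]
    have e4 : shuffle P X K (mon K S) (mon K S') T =
        tensorCoord P X K (coadd P X K (mon K T)) (S, S') := by
      simp only [shuffle, Finsupp.linearCombination_single, one_smul, shuffleMon]
      rfl
    rw [e4]

variable (P X) in
/-- The homogeneous component `A⁽ⁿ⁾`, spanned by the monomials with `n` leaves. -/
def homog (n : ℕ) : Submodule K (FreeAlg P X K) :=
  Finsupp.supported K K {m | m.degree = n}

variable (P X) in
/-- The space `Prim A` of primitive elements: `Δₐ(f) = f ⊗ 1 + 1 ⊗ f`. -/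
def prim : Submodule K (FreeAlg P X K) where
  carrier := {f | coadd P X K f = f ⊗ₜ[K] unit K + unit K ⊗ₜ[K] f}
  zero_mem' := by simp
  add_mem' := by
    intro f g hf hg
    simp only [Set.mem_ofPred_eq] at *
    rw [map_add, hf, hg, TensorProduct.add_tmul, TensorProduct.tmul_add]
    abel
  smul_mem' := by
    intro c f hf
    simp only [Set.mem_ofPred_eq] at *
    rw [map_smul, hf, smul_add, TensorProduct.smul_tmul', TensorProduct.tmul_smul]

variable (P X) in
/-- `Prim A⁽ⁿ⁾`, the homogeneous primitive elements of degree `n`. -/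
def primHomog (n : ℕ) : Submodule K (FreeAlg P X K) :=
  prim P X K ⊓ homog P X K n

variable (P X) in
/-- The orthogonal complement `B⁽ⁿ⁾` of `Prim A⁽ⁿ⁾` in `A⁽ⁿ⁾`. -/
def primOrth (n : ℕ) : Submodule K (FreeAlg P X K) where
  carrier := {a | a ∈ homog P X K n ∧ ∀ w ∈ primHomog P X K n, pairing P X K w a = 0}
  zero_mem' := ⟨Submodule.zero_mem _, fun w _ => map_zero _⟩
  add_mem' := fun ha hb => ⟨Submodule.add_mem _ ha.1 hb.1, fun w hw => by
    rw [map_add, ha.2 w hw, hb.2 w hw, add_zero]⟩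
  smul_mem' := fun c a ha => ⟨Submodule.smul_mem _ c ha.1, fun w hw => by
    rw [map_smul, ha.2 w hw, smul_zero]⟩

/-- The iterated shuffle product `f₁ ⧢ (f₂ ⧢ (⋯ ⧢ fₖ))` of a list of elements; the empty product
is `1`. -/
def shuffleList (l : List (FreeAlg P X K)) : FreeAlg P X K :=
  l.foldr (fun f g => shuffle P X K f g) (unit K)

/-! ## The operads and their generating series -/

variable (P) in
/-- The space `𝒫(n)` of `n`-ary operations of the operad `𝒫 = Mag` or `𝒫 = MagOmega`: the span of
the reduced planar trees (all internal vertices having admissible arities) whose leaves are labelled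
bijectively by `x₁, …, xₙ`. The tree is identified with the value of the operation on
the generators `x₁, …, xₙ` of the free algebra. -/
def operadSpace (n : ℕ) : Submodule K (FreeAlg P (Fin n) K) :=
  Finsupp.supported K K {m | ∃ T : PRTree P (Fin n), m = some T ∧ T.content = Finset.univ.val}

variable (P) in
/-- The space `(Prim 𝒫)(n)` of `n`-ary operations of the operad `Prim 𝒫`: those operations in
`𝒫(n)` whose value on the generators `x₁, …, xₙ` of the free algebra is primitive. -/
def primOperadSpace (n : ℕ) : Submodule K (FreeAlg P (Fin n) K) :=
  operadSpace P K n ⊓ prim P (Fin n) K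

/-- The generating series `∑_{n ≥ 1} (dim 𝒱(n) / n!) tⁿ` of a sequence of spaces with the dimensions
`d n = dim 𝒱(n)`. -/
def genSeries (d : ℕ → ℕ) : PowerSeries ℚ :=
  PowerSeries.mk fun n => if n = 0 then 0 else (d n : ℚ) / (n.factorial : ℚ)

end MagPBW
end

open scoped TensorProduct

noncomputable section

namespace MagPBW

universe u v

variable {P : Kind} {X : Type u} (K : Type v) [Field K]

/-! ## Homomorphisms out of the free unitary algebra -/

/-! The co-addition `Δ` is cocommutative, counital and coassociative, because each of these
identities compares two homomorphisms out of the free algebra that agree on `1` and on the leaves.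
Dually, `⧢` is commutative, unital and associative. What remains is that `(A, ⧢)` is a polynomial
algebra on `Prim A`.

Generation. By duality, an element is primitive iff it has no constant term and is orthogonal to all
products `S ⧢ S'` of nonempty monomials. The coefficients of `Δ` are natural numbers, and only
finitely many monomials have a given multiset of leaf labels (their content). Orthogonal projection
can therefore be carried out over `ℚ`, where the form is positive definite, and transported to `K`.
Hence every nonempty monomial is a primitive plus a decomposable element
(`exists_prim_sub_mem_decomp`). By induction on the degree `Prim A` generates, and the form is
nondegenerate on `Prim A` even if it has isotropic vectors over `K`.

Independence. For primitive `w` the operator `h ↦ w ∨ h` is a coderivation, since `1` is neutral for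
`∨²`; so its adjoint is a derivation of `⧢`. It sends a homogeneous `f` with `deg f ≤ deg w` to `⟨f,
w⟩ · 1`, hence acts as a directional derivative on polynomials in such generators. Applied to a
relation, these derivations give relations of smaller total degree. Nondegeneracy then makes every
partial derivative in a top-degree generator vanish, and in characteristic `0` such generators do
not occur (`aeval_injective`).

For (iii), the sorted products are the polynomial monomials of weight `n` in generators of degree
below `n`. Each has at least two factors, so it is orthogonal to the primitives, and nondegeneracy
shows that nothing else is. For (ii), the isomorphism respects contents. In a multilinear monomial
exactly one primitive factor contains a distinguished label, which gives a binomial recursion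
equivalent to `F' = G' F` with `F = 1 + f^𝒫` and `G = f^{Prim 𝒫}`, that is `G = log F`. -/

theorem multilinear_ext_single {N M : Type*} [AddCommGroup M] [Module K M] {k : ℕ}
    {F G : MultilinearMap K (fun _ : Fin k => N →₀ K) M}
    (h : ∀ p : Fin k → N, F (fun i => Finsupp.single (p i) 1) = G fun i => Finsupp.single (p i) 1) :
    F = G :=
  Module.Basis.ext_multilinear (fun _ => Finsupp.basisSingleOne) fun p => by
    simpa only [Finsupp.coe_basisSingleOne] using h p

theorem vee_mon (k : ℕ) (m : Fin k → Monomial P X) :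
    vee K k (fun i => mon K (m i)) = mon K (veeMon k m) := by
  rw [vee, multiExtend_single]; simp

theorem veeMon_some {k : ℕ} (hk : P.Arity k) (c : Fin k → PRTree P X) :
    veeMon k (fun i => some (c i)) = some (.node k hk c) := by
  have h1 : (List.ofFn fun i => (some (c i) : Monomial P X)).reduceOption = List.ofFn c := by
    rw [List.ofFn_comp' c some, List.reduceOption, List.filterMap_map]
    exact List.filterMap_some
  have h2 := hk.two_le
  have key : ∀ l : List (PRTree P X), 2 ≤ l.length → ∀ h : P.Arity l.length,
      graft l = some (.node _ h l.get) := by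
    intro l hl h
    match l, hl with
    | T :: T' :: l, _ => rw [graft, dif_pos h]
  have hl : (List.ofFn c).length = k := List.length_ofFn
  rw [veeMon, h1, key _ (by omega) (by rwa [hl])]
  -- The arity produced by `graft` is a list length that equals `k` only propositionally, so the
  -- families of subtrees are compared heterogeneously.
  congr 1
  rw [PRTree.node.injEq]
  refine ⟨hl, ?_⟩
  apply Function.hfunext (by rw [hl])
  intro a b hab
  have : (a : ℕ) = b := (Fin.heq_ext_iff hl).mp hab
  simp [this]

theorem content_eq_zero_iff (m : Monomial P X) : m.content = 0 ↔ m = none := by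
  cases m with
  | none => simp [Monomial.content]
  | some T =>
    have := T.content_card_pos
    simp only [Monomial.content, reduceCtorEq, iff_false]
    rintro h
    simp [h] at this

theorem veeMon_eq_none_iff {k : ℕ} (hk : P.Arity k) (m : Fin k → Monomial P X) :
    veeMon k m = none ↔ ∀ i, m i = none := by
  rw [← content_eq_zero_iff, content_veeMon hk]
  simp [Finset.sum_eq_zero_iff, content_eq_zero_iff]

/-- A linear map from the free algebra to a space with basis `N` is a homomorphism for the
operations which are the multilinear extensions of the operations `op` on `N`. -/
def IsOpHom {N : Type*} (op : ∀ k, (Fin k → N) → N) (θ : FreeAlg P X K →ₗ[K] N →₀ K) : Prop :=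
  ∀ k, P.Arity k → ∀ a, θ (vee K k a) = multiExtend K (op k) fun i => θ (a i)

variable {K}

/-- The empty tree and the leaves generate the algebra under the `∨ᵏ`, so induction on trees
suffices. The coalgebra identities below are all instances of this uniqueness. -/
theorem IsOpHom.ext {N : Type*} {op : ∀ k, (Fin k → N) → N} {θ θ' : FreeAlg P X K →ₗ[K] N →₀ K}
    (h : IsOpHom K op θ) (h' : IsOpHom K op θ') (hu : θ (unit K) = θ' (unit K))
    (hx : ∀ x, θ (mon K (some (.leaf x))) = θ' (mon K (some (.leaf x)))) : θ = θ' := by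
  refine Finsupp.lhom_ext' fun m => LinearMap.ext_ring ?_
  simp only [LinearMap.comp_apply, Finsupp.lsingle_apply]
  cases m with
  | none => exact hu
  | some T =>
    induction T with
    | leaf x => exact hx x
    | node k hk c ih =>
      have := vee_mon K k fun i => some (c i)
      rw [veeMon_some hk] at this
      rw [← mon, ← this, h k hk, h' k hk]
      simp only [ih]

theorem IsOpHom.comp {N N' : Type*} {op : ∀ k, (Fin k → N) → N} {op' : ∀ k, (Fin k → N') → N'}
    {θ : FreeAlg P X K →ₗ[K] N →₀ K} (h : IsOpHom K op θ) {ψ : (N →₀ K) →ₗ[K] N' →₀ K}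
    (hψ : ∀ k, P.Arity k → ∀ p : Fin k → N, ψ (Finsupp.single (op k p) 1) =
      multiExtend K (op' k) fun i => ψ (Finsupp.single (p i) 1)) :
    IsOpHom K op' (ψ ∘ₗ θ) := by
  intro k hk a
  have : ψ.compMultilinearMap (multiExtend K (op k)) =
      (multiExtend K (op' k)).compLinearMap fun _ => ψ :=
    multilinear_ext_single K fun p => by
      simpa [multiExtend_single] using hψ k hk p
  have h2 := congrArg (fun F => F fun i => θ (a i)) this
  simpa [h k hk a] using h2

/-- The maps `r i` may depend on the slot. In the proof of coassociativity they insert the component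
of the `i`-th argument that is not being split. -/
theorem multiExtend_mapDomain {N N' : Type*} {k : ℕ} (op : (Fin k → N) → N)
    (op' : (Fin k → N') → N') (r : Fin k → N → N') (r' : N → N')
    (hr : ∀ p, op' (fun i => r i (p i)) = r' (op p)) (t : Fin k → N →₀ K) :
    multiExtend K op' (fun i => (t i).mapDomain (r i)) = (multiExtend K op t).mapDomain r' := by
  have : (multiExtend K op').compLinearMap (fun i => Finsupp.lmapDomain K K (r i)) =
      (Finsupp.lmapDomain K K r').compMultilinearMap (multiExtend K op) :=
    multilinear_ext_single K fun p => by
      simp [multiExtend_single, Finsupp.mapDomain_single, hr]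
  exact congrArg (fun F => F t) this

/-- The componentwise operations on pairs of monomials. -/
def pairOp (k : ℕ) (m : Fin k → Monomial P X × Monomial P X) : Monomial P X × Monomial P X :=
  (veeMon k fun i => (m i).1, veeMon k fun i => (m i).2)

/-- The componentwise operations on triples of monomials. -/
def tripleOp (k : ℕ) (m : Fin k → Monomial P X × Monomial P X × Monomial P X) :
    Monomial P X × Monomial P X × Monomial P X :=
  (veeMon k fun i => (m i).1, veeMon k fun i => (m i).2.1, veeMon k fun i => (m i).2.2)

variable (P X K) in
/-- The co-addition in coordinates. -/
def cop : FreeAlg P X K →ₗ[K] (Monomial P X × Monomial P X →₀ K) :=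
  (tensorCoord P X K).toLinearMap ∘ₗ coadd P X K

theorem cop_apply (f : FreeAlg P X K) : cop P X K f = tensorCoord P X K (coadd P X K f) := rfl

theorem isOpHom_cop : IsOpHom K pairOp (cop P X K) := by
  intro k hk a
  rw [cop_apply, coadd_vee K hk, veeTensor]
  simp only [LinearMap.compMultilinearMap_apply, MultilinearMap.compLinearMap_apply,
    LinearEquiv.coe_coe, LinearEquiv.apply_symm_apply]
  rfl

theorem cop_unit : cop P X K (unit K) = Finsupp.single (none, none) 1 := by
  simp [cop_apply, coadd, coaddMon]

theorem cop_leaf (x : X) : cop P X K (mon K (some (.leaf x))) =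
    Finsupp.single (some (.leaf x), none) 1 + Finsupp.single (none, some (.leaf x)) 1 := by
  simp [cop_apply, coadd, coaddMon, coaddTree]

/-- The flip commutes with componentwise operations and fixes the values of `Δ` on `1` and on the
leaves. -/
theorem cop_swap (f : FreeAlg P X K) : (cop P X K f).mapDomain Prod.swap = cop P X K f := by
  have : Finsupp.lmapDomain K K Prod.swap ∘ₗ cop P X K = cop P X K := by
    refine IsOpHom.ext (isOpHom_cop.comp (op' := pairOp) fun k hk p => ?_) isOpHom_cop ?_ ?_
    · simp [multiExtend_single, Finsupp.mapDomain_single, pairOp]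
    · simp [cop_unit, Finsupp.mapDomain_single]
    · intro x
      simp [cop_leaf, Finsupp.mapDomain_single, Finsupp.mapDomain_add, add_comm]
  exact congrArg (fun F => F f) this

open Classical in
theorem cop_counit (f : FreeAlg P X K) (T : Monomial P X) : cop P X K f (none, T) = f T := by
  -- This is `ε ⊗ id` with `ε` the coefficient of the empty tree. It respects the operations because
  -- a grafting is empty only if all its arguments are.
  let ψ : (Monomial P X × Monomial P X →₀ K) →ₗ[K] Monomial P X →₀ K :=
    Finsupp.linearCombination K fun p => if p.1 = none then Finsupp.single p.2 1 else 0
  have h1 : ψ ∘ₗ cop P X K = LinearMap.id := by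
    refine IsOpHom.ext (op := veeMon) (isOpHom_cop.comp fun k hk p => ?_) (fun k hk a => rfl) ?_ ?_
    · simp only [ψ, Finsupp.linearCombination_single, one_smul, pairOp, veeMon_eq_none_iff hk]
      split_ifs with h
      · simp [h, multiExtend_single]
      · push Not at h
        obtain ⟨i, hi⟩ := h
        rw [MultilinearMap.map_coord_zero _ i]
        simp [hi]
    · simp [cop_unit, ψ]
    · intro x
      simp [cop_leaf, ψ]
  have h2 : ∀ t : Monomial P X × Monomial P X →₀ K, ψ t T = t (none, T) := by
    intro t
    induction t using Finsupp.induction_linear with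
    | zero => simp
    | add x y hx hy => simp only [map_add, Finsupp.add_apply, hx, hy]
    | single p c =>
      obtain ⟨a, b⟩ := p
      by_cases h : a = none <;> simp [ψ, h, Finsupp.single_apply]
  rw [← h2, ← LinearMap.comp_apply, h1, LinearMap.id_apply]

theorem cop_symm (f : FreeAlg P X K) (S S' : Monomial P X) :
    cop P X K f (S, S') = cop P X K f (S', S) := by
  conv_lhs => rw [← cop_swap]
  exact Finsupp.mapDomain_apply Prod.swap_injective _ (S', S)

theorem cop_counit' (f : FreeAlg P X K) (T : Monomial P X) : cop P X K f (T, none) = f T := by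
  rw [cop_symm, cop_counit]

variable (P X K) in
/-- `Δ ⊗ id` in coordinates. -/
def copLeft : (Monomial P X × Monomial P X →₀ K) →ₗ[K]
    (Monomial P X × Monomial P X × Monomial P X →₀ K) :=
  Finsupp.linearCombination K fun p =>
    (cop P X K (mon K p.1)).mapDomain fun q => (q.1, q.2, p.2)

variable (P X K) in
/-- `id ⊗ Δ` in coordinates. -/
def copRight : (Monomial P X × Monomial P X →₀ K) →ₗ[K]
    (Monomial P X × Monomial P X × Monomial P X →₀ K) :=
  Finsupp.linearCombination K fun p =>
    (cop P X K (mon K p.2)).mapDomain fun q => (p.1, q.1, q.2)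

/-- The co-addition is coassociative. -/
theorem cop_coassoc (f : FreeAlg P X K) :
    copLeft P X K (cop P X K f) = copRight P X K (cop P X K f) := by
  have : copLeft P X K ∘ₗ cop P X K = copRight P X K ∘ₗ cop P X K := by
    refine IsOpHom.ext (op := tripleOp) (isOpHom_cop.comp fun k hk p => ?_)
      (isOpHom_cop.comp fun k hk p => ?_) ?_ ?_
    -- `Δ` acts on the first component only, so the operation on triples is the one on pairs with
    -- the untouched third components grafted alongside.
    · simp only [copLeft, Finsupp.linearCombination_single, one_smul, pairOp]
      rw [← vee_mon, isOpHom_cop k hk]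
      exact (multiExtend_mapDomain (pairOp k) (tripleOp k) (fun i q => (q.1, q.2, (p i).2))
        (fun q => (q.1, q.2, veeMon k fun i => (p i).2)) (fun _ => rfl) _).symm
    · simp only [copRight, Finsupp.linearCombination_single, one_smul, pairOp]
      rw [← vee_mon, isOpHom_cop k hk]
      exact (multiExtend_mapDomain (pairOp k) (tripleOp k) (fun i q => ((p i).1, q.1, q.2))
        (fun q => (veeMon k fun i => (p i).1, q.1, q.2)) (fun _ => rfl) _).symm
    · simp [cop_unit, copLeft, copRight, Finsupp.mapDomain_single]
    · intro x
      simp [cop_unit, cop_leaf, copLeft, copRight, Finsupp.mapDomain_single,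
        Finsupp.mapDomain_add, add_assoc]
  exact congrArg (fun F => F f) this

theorem content_of_cop_ne_zero {T S S' : Monomial P X} (h : cop P X K (mon K T) (S, S') ≠ 0) :
    S.content + S'.content = T.content := by
  cases T with
  | none =>
    classical
    rw [cop_unit, Finsupp.single_apply] at h
    simp only [Prod.mk.injEq, ne_eq, ite_eq_right_iff, one_ne_zero, imp_false, not_not] at h
    simp [← h.1, ← h.2, Monomial.content]
  | some T =>
    refine content_of_coaddTree_ne_zero K T S S' ?_
    simpa [cop_apply, coadd, coaddMon] using h

/-! ## Integrality of the co-addition -/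

/-- The additive monoid generated by the basis vectors consists of the combinations with natural
coefficients. The operations send basis vectors to basis vectors, so they preserve it. -/
theorem multiExtend_mem_closure {N N' : Type*} {k : ℕ} (op : (Fin k → N) → N')
    (t : Fin k → N →₀ K)
    (ht : ∀ i, t i ∈ AddSubmonoid.closure (Set.range fun n => Finsupp.single n (1 : K))) :
    multiExtend K op t ∈ AddSubmonoid.closure (Set.range fun n => Finsupp.single n (1 : K)) := by
  classical
  -- Induction on the set `s` of slots holding a general combination; the other slots hold single
  -- basis vectors.
  suffices H : ∀ (s : Finset (Fin k)) (t : Fin k → N →₀ K),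
      (∀ i ∈ s, t i ∈ AddSubmonoid.closure (Set.range fun n => Finsupp.single n (1 : K))) →
      (∀ i ∉ s, t i ∈ Set.range fun n => Finsupp.single n (1 : K)) →
      multiExtend K op t ∈ AddSubmonoid.closure (Set.range fun n => Finsupp.single n (1 : K)) from
    H Finset.univ t (fun i _ => ht i) (fun i hi => absurd (Finset.mem_univ i) hi)
  intro s
  induction s using Finset.induction_on with
  | empty =>
    intro t _ h
    choose p hp using fun i => h i (Finset.notMem_empty i)
    obtain rfl : (fun i => Finsupp.single (p i) 1) = t := funext hp
    rw [multiExtend_single]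
    exact AddSubmonoid.subset_closure ⟨op p, by simp⟩
  | insert j s hj ih =>
    intro t h1 h2
    have key : ∀ y ∈ AddSubmonoid.closure (Set.range fun n : N => Finsupp.single n (1 : K)),
        multiExtend K op (Function.update t j y) ∈
          AddSubmonoid.closure (Set.range fun n => Finsupp.single n (1 : K)) := by
      intro y hy
      induction hy using AddSubmonoid.closure_induction with
      | mem y hy =>
        refine ih _ (fun i hi => ?_) fun i hi => ?_
        · rw [Function.update_of_ne (by rintro rfl; exact hj hi)]
          exact h1 i (Finset.mem_insert_of_mem hi)
        · by_cases hij : i = j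
          · subst hij; simpa using hy
          · rw [Function.update_of_ne hij]
            exact h2 i (by simp [hij, hi])
      | zero => rw [MultilinearMap.map_update_zero]; exact zero_mem _
      | add x y _ _ hx hy => rw [MultilinearMap.map_update_add]; exact add_mem hx hy
    simpa using key (t j) (h1 j (Finset.mem_insert_self j s))

/-- The coefficients of the co-addition are natural numbers. -/
theorem cop_mon_mem_range_natCast (T S S' : Monomial P X) :
    ∃ n : ℕ, cop P X K (mon K T) (S, S') = n := by
  have h1 : cop P X K (mon K T) ∈
      AddSubmonoid.closure (Set.range fun n => Finsupp.single n (1 : K)) := by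
    cases T with
    | none => rw [cop_unit]; exact AddSubmonoid.subset_closure ⟨_, rfl⟩
    | some T =>
      induction T with
      | leaf x =>
        rw [cop_leaf]
        exact add_mem (AddSubmonoid.subset_closure ⟨_, rfl⟩) (AddSubmonoid.subset_closure ⟨_, rfl⟩)
      | node k hk c ih =>
        rw [← veeMon_some hk, ← vee_mon, isOpHom_cop k hk]
        exact multiExtend_mem_closure _ _ ih
  have h2 : ∀ t ∈ AddSubmonoid.closure
      (Set.range fun n : Monomial P X × Monomial P X => Finsupp.single n (1 : K)),
      ∃ n : ℕ, t (S, S') = n := by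
    classical
    intro t ht
    induction ht using AddSubmonoid.closure_induction with
    | mem x hx =>
      obtain ⟨n, rfl⟩ := hx
      by_cases h : n = (S, S')
      · exact ⟨1, by simp [h]⟩
      · exact ⟨0, by simp [h]⟩
    | zero => exact ⟨0, by simp⟩
    | add x y _ _ hx hy =>
      obtain ⟨a, ha⟩ := hx
      obtain ⟨b, hb⟩ := hy
      exact ⟨a + b, by simp [ha, hb]⟩
  exact h2 _ h1

/-! ## The shuffle algebra -/

theorem pairing_mon_right (f : FreeAlg P X K) (T : Monomial P X) :
    pairing P X K f (mon K T) = f T := by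
  classical
  induction f using Finsupp.induction_linear with
  | zero => simp
  | add x y hx hy => rw [map_add, LinearMap.add_apply, hx, hy, Finsupp.add_apply]
  | single S c => simp [pairing, Finsupp.single_apply, eq_comm]

theorem pairing_mon_left (f : FreeAlg P X K) (T : Monomial P X) :
    pairing P X K (mon K T) f = f T := by
  simp [pairing]

theorem pairing_comm (f g : FreeAlg P X K) : pairing P X K f g = pairing P X K g f := by
  induction g using Finsupp.induction_linear with
  | zero => simp
  | add x y hx hy => rw [map_add, map_add, LinearMap.add_apply, hx, hy]
  | single S c =>
    have : (Finsupp.single S c : FreeAlg P X K) = c • mon K S := by simp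
    rw [this, map_smul, map_smul, LinearMap.smul_apply, pairing_mon_right, pairing_mon_left]

theorem pairing_eq_sum (f g : FreeAlg P X K) :
    pairing P X K f g = ∑ T ∈ f.support, f T * g T := by
  rw [pairing, Finsupp.linearCombination_apply, Finsupp.sum, LinearMap.sum_apply]
  simp

theorem exists_of_pairing_ne_zero {f g : FreeAlg P X K} (h : pairing P X K f g ≠ 0) :
    ∃ T, f T ≠ 0 ∧ g T ≠ 0 := by
  rw [pairing_eq_sum] at h
  obtain ⟨T, -, hT⟩ := Finset.exists_ne_zero_of_sum_ne_zero h
  exact ⟨T, left_ne_zero_of_mul hT, right_ne_zero_of_mul hT⟩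

theorem ext_of_pairing {f g : FreeAlg P X K} (h : ∀ a, pairing P X K f a = pairing P X K g a) :
    f = g := by
  ext T
  rw [← pairing_mon_right, h, pairing_mon_right]

theorem shuffle_mon_mon (S S' : Monomial P X) :
    shuffle P X K (mon K S) (mon K S') = shuffleMon K S S' := by
  simp [shuffle]

theorem shuffleMon_apply (S S' T : Monomial P X) :
    shuffleMon K S S' T = cop P X K (mon K T) (S, S') := rfl

theorem shuffle_comm (f g : FreeAlg P X K) : shuffle P X K f g = shuffle P X K g f := by
  have : shuffle P X K = (shuffle P X K).flip := by
    ext S S' T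
    simp only [LinearMap.coe_comp, Function.comp_apply, Finsupp.lsingle_apply,
      LinearMap.flip_apply]
    rw [← mon, ← mon, shuffle_mon_mon, shuffle_mon_mon, shuffleMon_apply, shuffleMon_apply,
      cop_symm]
  exact congrArg (fun F => F f g) this

theorem unit_shuffle (f : FreeAlg P X K) : shuffle P X K (unit K) f = f := by
  have : shuffle P X K (unit K) = LinearMap.id := by
    classical
    ext S T
    simp only [LinearMap.coe_comp, Function.comp_apply, Finsupp.lsingle_apply, LinearMap.id_apply]
    rw [← mon, shuffle_mon_mon, shuffleMon_apply, cop_counit, Finsupp.single_apply,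
      Finsupp.single_apply]
    simp only [eq_comm]
  exact congrArg (fun F => F f) this

/-- In coordinates, `Δ ⊗ id` is the transpose of `⧢ ⊗ id`. With `copRight_apply` this turns
coassociativity into associativity of `⧢`. -/
theorem copLeft_apply (t : Monomial P X × Monomial P X →₀ K) (S S' S'' : Monomial P X) :
    copLeft P X K t (S, S', S'') = (shuffleMon K S S').sum fun U c => c * t (U, S'') := by
  classical
  induction t using Finsupp.induction_linear with
  | zero => simp
  | add x y hx hy =>
    simp only [map_add, Finsupp.add_apply, hx, hy, mul_add, Finsupp.sum_add]
  | single p d =>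
    obtain ⟨a, b⟩ := p
    simp only [copLeft, Finsupp.linearCombination_single, Finsupp.smul_apply, smul_eq_mul]
    by_cases h : b = S''
    · subst h
      have hinj : Function.Injective fun q : Monomial P X × Monomial P X => (q.1, q.2, b) := by
        rintro ⟨x, y⟩ ⟨x', y'⟩ h
        simp only [Prod.mk.injEq, and_true] at h
        exact Prod.ext h.1 h.2
      rw [show (S, S', b) = (fun q : Monomial P X × Monomial P X => (q.1, q.2, b)) (S, S') from rfl,
        Finsupp.mapDomain_apply hinj, ← shuffleMon_apply]
      rw [Finsupp.sum, Finset.sum_eq_single a]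
      · simp [mul_comm]
      · intro U _ hU
        simp [hU.symm]
      · intro ha
        simp [Finsupp.notMem_support_iff.mp ha]
    · rw [Finsupp.mapDomain_of_notMem_range]
      · simp [h]
      · rintro ⟨q, hq⟩
        simp only [Prod.mk.injEq] at hq
        exact h hq.2.2

theorem copRight_apply (t : Monomial P X × Monomial P X →₀ K) (S S' S'' : Monomial P X) :
    copRight P X K t (S, S', S'') = (shuffleMon K S' S'').sum fun U c => c * t (S, U) := by
  classical
  induction t using Finsupp.induction_linear with
  | zero => simp
  | add x y hx hy =>
    simp only [map_add, Finsupp.add_apply, hx, hy, mul_add, Finsupp.sum_add]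
  | single p d =>
    obtain ⟨a, b⟩ := p
    simp only [copRight, Finsupp.linearCombination_single, Finsupp.smul_apply, smul_eq_mul]
    by_cases h : a = S
    · subst h
      have hinj : Function.Injective fun q : Monomial P X × Monomial P X => (a, q.1, q.2) := by
        rintro ⟨x, y⟩ ⟨x', y'⟩ h
        simp only [Prod.mk.injEq, true_and] at h
        exact Prod.ext h.1 h.2
      rw [show (a, S', S'') = (fun q : Monomial P X × Monomial P X => (a, q.1, q.2)) (S', S'')
        from rfl, Finsupp.mapDomain_apply hinj, ← shuffleMon_apply]
      rw [Finsupp.sum, Finset.sum_eq_single b]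
      · simp [mul_comm]
      · intro U _ hU
        simp [hU.symm]
      · intro ha
        simp [Finsupp.notMem_support_iff.mp ha]
    · rw [Finsupp.mapDomain_of_notMem_range]
      · simp [h]
      · rintro ⟨q, hq⟩
        simp only [Prod.mk.injEq] at hq
        exact h hq.1

theorem shuffle_mon_right_apply (f : FreeAlg P X K) (S T : Monomial P X) :
    shuffle P X K f (mon K S) T = f.sum fun U c => c * cop P X K (mon K T) (U, S) := by
  induction f using Finsupp.induction_linear with
  | zero => simp
  | add x y hx hy =>
    rw [map_add, LinearMap.add_apply, Finsupp.add_apply, hx, hy,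
      Finsupp.sum_add_index' (by simp) (by intros; ring)]
  | single U c =>
    have : (Finsupp.single U c : FreeAlg P X K) = c • mon K U := by simp
    rw [Finsupp.sum_single_index (by simp), this, map_smul, LinearMap.smul_apply, shuffle_mon_mon,
      Finsupp.smul_apply, smul_eq_mul, shuffleMon_apply]

/-- On monomials, the coefficients at `T` of the two sides are the coordinates at `S ⊗ S' ⊗ S''` of
`(Δ ⊗ id)Δ(T)` and `(id ⊗ Δ)Δ(T)`. -/
theorem shuffle_assoc (f g h : FreeAlg P X K) :
    shuffle P X K (shuffle P X K f g) h = shuffle P X K f (shuffle P X K g h) := by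
  induction f using Finsupp.induction_linear with
  | zero => simp
  | add x y hx hy => simp only [map_add, LinearMap.add_apply, hx, hy]
  | single S c =>
  induction g using Finsupp.induction_linear with
  | zero => simp
  | add x y hx hy => simp only [map_add, LinearMap.add_apply, hx, hy]
  | single S' c' =>
  induction h using Finsupp.induction_linear with
  | zero => simp
  | add x y hx hy => simp only [map_add, hx, hy]
  | single S'' c'' =>
  have e1 : (Finsupp.single S c : FreeAlg P X K) = c • mon K S := by simp
  have e2 : (Finsupp.single S' c' : FreeAlg P X K) = c' • mon K S' := by simp
  have e3 : (Finsupp.single S'' c'' : FreeAlg P X K) = c'' • mon K S'' := by simp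
  rw [e1, e2, e3]
  simp only [map_smul, LinearMap.smul_apply]
  congr 3
  ext T
  rw [shuffle_mon_mon, shuffle_mon_mon, shuffle_mon_right_apply, ← copLeft_apply, cop_coassoc,
    copRight_apply, shuffle_comm, shuffle_mon_right_apply]
  simp only [cop_symm]

variable (P X K) in
/-- The space `A` with the shuffle product as its multiplication. -/
def ShuffleAlg : Type max u v := FreeAlg P X K

instance : AddCommGroup (ShuffleAlg P X K) := inferInstanceAs (AddCommGroup (FreeAlg P X K))

instance : Module K (ShuffleAlg P X K) := inferInstanceAs (Module K (FreeAlg P X K))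

/-- The identity, as a linear isomorphism from `A` to the shuffle algebra. -/
def toShuffle : FreeAlg P X K ≃ₗ[K] ShuffleAlg P X K := LinearEquiv.refl K (FreeAlg P X K)

instance : CommRing (ShuffleAlg P X K) where
  mul f g := toShuffle (shuffle P X K (toShuffle.symm f) (toShuffle.symm g))
  one := toShuffle (unit K)
  mul_assoc f g h := shuffle_assoc (K := K) (P := P) (X := X) f g h
  mul_comm f g := shuffle_comm (K := K) (P := P) (X := X) f g
  one_mul f := unit_shuffle (K := K) (P := P) (X := X) f
  mul_one f := (shuffle_comm (K := K) (P := P) (X := X) f _).trans (unit_shuffle f)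
  left_distrib f g h := map_add (shuffle P X K (toShuffle.symm f)) g h
  right_distrib f g h := LinearMap.map_add₂ (shuffle P X K) f g h
  zero_mul f := LinearMap.map_zero₂ (shuffle P X K) f
  mul_zero f := map_zero (shuffle P X K (toShuffle.symm f))
  neg_add_cancel := neg_add_cancel
  zsmul := fun n f => n • f
  zsmul_zero' := SubNegMonoid.zsmul_zero'
  zsmul_succ' := SubNegMonoid.zsmul_succ'
  zsmul_neg' := SubNegMonoid.zsmul_neg'
  nsmul := fun n f => n • f
  nsmul_zero := AddMonoid.nsmul_zero
  nsmul_succ := AddMonoid.nsmul_succ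
  sub_eq_add_neg := sub_eq_add_neg

instance : Algebra K (ShuffleAlg P X K) :=
  Algebra.ofModule
    (fun r f g => LinearMap.map_smul₂ (shuffle P X K) r (toShuffle.symm f) (toShuffle.symm g))
    (fun r f g => map_smul (shuffle P X K (toShuffle.symm f)) r (toShuffle.symm g))

theorem toShuffle_shuffle (f g : FreeAlg P X K) :
    toShuffle (shuffle P X K f g) = toShuffle f * toShuffle g := rfl

theorem toShuffle_unit : toShuffle (unit K : FreeAlg P X K) = 1 := rfl

theorem toShuffle_shuffleList (l : List (FreeAlg P X K)) :
    toShuffle (shuffleList K l) = (l.map toShuffle).prod := by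
  induction l with
  | nil => rfl
  | cons f l ih => rw [List.map_cons, List.prod_cons, ← ih]; rfl

/-! ## Gradings -/

variable (P X K) in
/-- The space of elements of a given content. -/
def contentComp (c : Multiset X) : Submodule K (FreeAlg P X K) :=
  Finsupp.supported K K {m | m.content = c}

theorem mem_contentComp {c : Multiset X} {f : FreeAlg P X K} :
    f ∈ contentComp P X K c ↔ ∀ T, f T ≠ 0 → T.content = c := by
  rw [contentComp, Finsupp.mem_supported']
  exact forall_congr' fun T => not_imp_comm

theorem mem_homog {n : ℕ} {f : FreeAlg P X K} :
    f ∈ homog P X K n ↔ ∀ T, f T ≠ 0 → T.degree = n := by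
  rw [homog, Finsupp.mem_supported']
  exact forall_congr' fun T => not_imp_comm

theorem contentComp_le_homog (c : Multiset X) :
    contentComp P X K c ≤ homog P X K (Multiset.card c) := fun _ hf =>
  mem_homog.mpr fun _ hT => congrArg Multiset.card (mem_contentComp.mp hf _ hT)

theorem mon_mem_contentComp (T : Monomial P X) : mon K T ∈ contentComp P X K T.content := by
  classical
  refine mem_contentComp.mpr fun S hS => ?_
  rw [Finsupp.single_apply] at hS
  by_contra h
  exact hS (if_neg (by rintro rfl; exact h rfl))

theorem shuffleMon_mem_contentComp (S S' : Monomial P X) :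
    shuffleMon K S S' ∈ contentComp P X K (S.content + S'.content) :=
  mem_contentComp.mpr fun _ hT => (content_of_cop_ne_zero (K := K) hT).symm

theorem pairing_eq_zero_of_homog {m n : ℕ} (h : m ≠ n) {f g : FreeAlg P X K}
    (hf : f ∈ homog P X K m) (hg : g ∈ homog P X K n) : pairing P X K f g = 0 := by
  by_contra H
  obtain ⟨T, h1, h2⟩ := exists_of_pairing_ne_zero H
  exact h ((mem_homog.mp hf T h1).symm.trans (mem_homog.mp hg T h2))

theorem finite_content_le (c : Multiset X) : {T : Monomial P X | T.content ≤ c}.Finite := by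
  classical
  have : {T : Monomial P X | T.content ≤ c} ⊆
      {none} ∪ ⋃ d ∈ {d | d ∈ c.powerset}, some '' {T : PRTree P X | T.content = d} := by
    intro T hT
    cases T with
    | none => simp
    | some T =>
      right
      simp only [Set.mem_iUnion]
      exact ⟨T.content, Multiset.mem_powerset.mpr hT, T, rfl, rfl⟩
  refine Set.Finite.subset ((Set.finite_singleton _).union ?_) this
  exact (Multiset.finite_toSet c.powerset).biUnion fun d _ => (finite_trees_content d).image _

theorem Kind.arity_two (P : Kind) : P.Arity 2 := by
  cases P <;> simp [Kind.Arity]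

theorem degree_eq_zero_iff (T : Monomial P X) : T.degree = 0 ↔ T = none := by
  rw [Monomial.degree, Multiset.card_eq_zero, content_eq_zero_iff]

/-! ## Grafting a primitive element is dual to a derivation -/

/-- The operator `h ↦ w ∨ h`. -/
def graftLeft (w : FreeAlg P X K) : FreeAlg P X K →ₗ[K] FreeAlg P X K :=
  (vee K 2).toLinearMap ![w, 0] 1

theorem graftLeft_apply (w h : FreeAlg P X K) : graftLeft w h = vee K 2 ![w, h] := by
  rw [graftLeft, MultilinearMap.toLinearMap_apply]
  congr 1
  funext i
  fin_cases i <;> rfl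

theorem exists_of_graftLeft_ne_zero {w h : FreeAlg P X K} {T : Monomial P X}
    (H : graftLeft w h T ≠ 0) :
    ∃ S S', w S ≠ 0 ∧ h S' ≠ 0 ∧ T.content = S.content + S'.content := by
  rw [graftLeft_apply] at H
  obtain ⟨p, rfl, hp⟩ := exists_of_multiExtend_ne_zero K _ _ _ H
  refine ⟨p 0, p 1, hp 0, hp 1, ?_⟩
  rw [content_veeMon P.arity_two, Fin.sum_univ_two]

theorem vee_two_mon (S T : Monomial P X) :
    vee K 2 ![mon K S, mon K T] = mon K (veeMon 2 ![S, T]) := by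
  rw [← vee_mon]
  congr 1
  funext i
  fin_cases i <;> rfl

theorem graftLeft_unit (h : FreeAlg P X K) : graftLeft (unit K) h = h := by
  have : graftLeft (unit K) = (LinearMap.id : FreeAlg P X K →ₗ[K] FreeAlg P X K) := by
    refine Finsupp.lhom_ext' fun T => LinearMap.ext_ring ?_
    simp only [LinearMap.comp_apply, Finsupp.lsingle_apply, LinearMap.id_apply]
    rw [graftLeft_apply, vee_two_mon]
    cases T <;> simp [veeMon, graft, List.reduceOption]
  rw [this, LinearMap.id_apply]

theorem graftLeft_apply_unit (w : FreeAlg P X K) : graftLeft w (unit K) = w := by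
  rw [graftLeft_apply]
  have : (vee K 2).toLinearMap ![0, unit K] 0 =
      (LinearMap.id : FreeAlg P X K →ₗ[K] FreeAlg P X K) := by
    refine Finsupp.lhom_ext' fun T => LinearMap.ext_ring ?_
    simp only [LinearMap.comp_apply, Finsupp.lsingle_apply, LinearMap.id_apply,
      MultilinearMap.toLinearMap_apply]
    rw [show Function.update ![0, unit K] 0 (Finsupp.single T 1) = ![mon K T, mon K none] by
      funext i; fin_cases i <;> rfl, vee_two_mon]
    cases T <;> simp [veeMon, graft, List.reduceOption]
  have h2 := congrArg (fun F => F w) this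
  simp only [MultilinearMap.toLinearMap_apply, LinearMap.id_apply] at h2
  conv_rhs => rw [← h2]
  congr 1
  funext i
  fin_cases i <;> rfl

/-- Grafting adds contents, so only trees whose content lies below that of some monomial of `f`
contribute. There are finitely many of these even for infinite `X`, which is what lets the adjoint
take values in `A`. -/
theorem finite_support_pairing_graftLeft (w f : FreeAlg P X K) :
    (Function.support fun T : Monomial P X => pairing P X K f (graftLeft w (mon K T))).Finite := by
  classical
  refine Set.Finite.subset
    (Set.Finite.biUnion f.support.finite_toSet fun T _ => finite_content_le T.content)
    fun T' hT' => ?_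
  obtain ⟨T, h1, h2⟩ := exists_of_pairing_ne_zero hT'
  obtain ⟨S, S', -, hS', h3⟩ := exists_of_graftLeft_ne_zero h2
  simp only [Set.mem_iUnion]
  refine ⟨T, by simpa using h1, ?_⟩
  rw [Finsupp.single_apply] at hS'
  obtain rfl : T' = S' := by
    by_contra h; exact hS' (if_neg h)
  rw [Set.mem_ofPred_eq, h3]
  exact Multiset.le_add_left _ _

/-- The adjoint of the operator `h ↦ w ∨ h`. -/
def graftAdj (w : FreeAlg P X K) : FreeAlg P X K →ₗ[K] FreeAlg P X K where
  toFun f := Finsupp.ofSupportFinite _ (finite_support_pairing_graftLeft w f)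
  map_add' f g := by
    ext T
    simp [Finsupp.ofSupportFinite_coe]
  map_smul' r f := by
    ext T
    simp [Finsupp.ofSupportFinite_coe]

theorem graftAdj_apply (w f : FreeAlg P X K) (T : Monomial P X) :
    graftAdj w f T = pairing P X K f (graftLeft w (mon K T)) := rfl

theorem pairing_graftAdj (w f h : FreeAlg P X K) :
    pairing P X K (graftAdj w f) h = pairing P X K f (graftLeft w h) := by
  have : pairing P X K (graftAdj w f) = pairing P X K f ∘ₗ graftLeft w := by
    refine Finsupp.lhom_ext' fun T => LinearMap.ext_ring ?_
    simp only [LinearMap.comp_apply, Finsupp.lsingle_apply]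
    rw [← mon, pairing_mon_right, graftAdj_apply]
  rw [this, LinearMap.comp_apply]

theorem mem_prim {f : FreeAlg P X K} :
    f ∈ prim P X K ↔ coadd P X K f = f ⊗ₜ[K] unit K + unit K ⊗ₜ[K] f := Iff.rfl

theorem veeTensor_two_tmul (a b c d : FreeAlg P X K) :
    veeTensor K 2 ![a ⊗ₜ[K] b, c ⊗ₜ[K] d] = vee K 2 ![a, c] ⊗ₜ[K] vee K 2 ![b, d] := by
  rw [← veeTensor_tmul]
  congr 1
  funext i
  fin_cases i <;> rfl

/-- Since `1 ∨ b = b`, grafting with `w ⊗ 1` sends `a ⊗ b` to `(w ∨ a) ⊗ b`, and symmetrically for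
`1 ⊗ w`. Thus grafting with a primitive element is a coderivation. -/
theorem coadd_graftLeft {w : FreeAlg P X K} (hw : w ∈ prim P X K) (h : FreeAlg P X K) :
    coadd P X K (graftLeft w h) =
      TensorProduct.map (graftLeft w) LinearMap.id (coadd P X K h) +
        TensorProduct.map LinearMap.id (graftLeft w) (coadd P X K h) := by
  rw [graftLeft_apply, coadd_vee K P.arity_two]
  rw [show (fun i => coadd P X K (![w, h] i)) = ![coadd P X K w, coadd P X K h] by
    funext i; fin_cases i <;> rfl, mem_prim.mp hw]
  have key : (veeTensor K 2).toLinearMap ![w ⊗ₜ[K] unit K + unit K ⊗ₜ[K] w, 0] 1 =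
      TensorProduct.map (graftLeft w) LinearMap.id +
        TensorProduct.map LinearMap.id (graftLeft w) := by
    refine TensorProduct.ext' fun a b => ?_
    rw [MultilinearMap.toLinearMap_apply, LinearMap.add_apply, TensorProduct.map_tmul,
      TensorProduct.map_tmul, LinearMap.id_apply, LinearMap.id_apply]
    have e1 : ∀ t, Function.update ![t, 0] 1 (a ⊗ₜ[K] b) = ![t, a ⊗ₜ[K] b] := by
      intro t; funext i; fin_cases i <;> rfl
    have e2 : ∀ s t : FreeAlg P X K ⊗[K] FreeAlg P X K,
        veeTensor K 2 ![s + t, a ⊗ₜ[K] b] =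
          veeTensor K 2 ![s, a ⊗ₜ[K] b] + veeTensor K 2 ![t, a ⊗ₜ[K] b] := by
      intro s t
      have := (veeTensor K 2).cons_add ![a ⊗ₜ[K] b] s t
      exact this
    rw [e1, e2, veeTensor_two_tmul, veeTensor_two_tmul, ← graftLeft_apply, ← graftLeft_apply,
      ← graftLeft_apply, ← graftLeft_apply, graftLeft_unit, graftLeft_unit]
  have h2 := congrArg (fun F => F (coadd P X K h)) key
  rw [LinearMap.add_apply, MultilinearMap.toLinearMap_apply] at h2
  rw [← h2]
  congr 1
  funext i
  fin_cases i <;> rfl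

/-- The Leibniz rule is the transpose of the coderivation property. -/
theorem graftAdj_shuffle {w : FreeAlg P X K} (hw : w ∈ prim P X K) (f g : FreeAlg P X K) :
    graftAdj w (shuffle P X K f g) =
      shuffle P X K (graftAdj w f) g + shuffle P X K f (graftAdj w g) := by
  refine ext_of_pairing fun h => ?_
  have e : ∀ f, pairing P X K (graftAdj w f) = pairing P X K f ∘ₗ graftLeft w :=
    fun f => LinearMap.ext fun h => pairing_graftAdj w f h
  rw [map_add, LinearMap.add_apply, pairing_graftAdj, pairing_shuffle, pairing_shuffle,
    pairing_shuffle, coadd_graftLeft hw, map_add, map_add, e, e]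
  rw [TensorProduct.map_map, TensorProduct.map_map, LinearMap.comp_id, LinearMap.comp_id]

/-- The derivation of the shuffle algebra dual to grafting with a primitive element. -/
def primDerivation (w : prim P X K) : Derivation K (ShuffleAlg P X K) (ShuffleAlg P X K) :=
  Derivation.mk' (toShuffle.toLinearMap ∘ₗ graftAdj w.1 ∘ₗ toShuffle.symm.toLinearMap)
    fun f g => by
      simp only [LinearMap.comp_apply, LinearEquiv.coe_coe, smul_eq_mul]
      have := graftAdj_shuffle w.2 (toShuffle.symm f) (toShuffle.symm g)
      rw [add_comm, mul_comm g]
      exact congrArg toShuffle this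

theorem primDerivation_toShuffle (w : prim P X K) (f : FreeAlg P X K) :
    primDerivation w (toShuffle f) = toShuffle (graftAdj w.1 f) := rfl

/-- The coefficient at `T` is `⟨f, w ∨ T⟩`, and `w ∨ T` has degree `n + deg T`, which exceeds `m`
unless `T` is empty; there `w ∨ 1 = w`. -/
theorem graftAdj_of_homog {m n : ℕ} {w f : FreeAlg P X K} (hw : w ∈ homog P X K n)
    (hf : f ∈ homog P X K m) (hmn : m ≤ n) : graftAdj w f = pairing P X K f w • unit K := by
  ext T
  rw [graftAdj_apply]
  cases T with
  | none => rw [graftLeft_apply_unit]; simp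
  | some T =>
    simp only [Finsupp.smul_apply, ne_eq, reduceCtorEq, not_false_eq_true,
      Finsupp.single_eq_of_ne', smul_zero]
    by_contra H
    obtain ⟨U, h1, h2⟩ := exists_of_pairing_ne_zero H
    obtain ⟨S, S', h3, h4, h5⟩ := exists_of_graftLeft_ne_zero h2
    have e1 := mem_homog.mp hf U h1
    have e2 := mem_homog.mp hw S h3
    classical
    rw [Finsupp.single_apply] at h4
    obtain rfl : some T = S' := by
      by_contra h; exact h4 (if_neg h)
    have e3 := T.content_card_pos
    have e4 := congrArg Multiset.card h5
    rw [Multiset.card_add] at e4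
    simp only [Monomial.degree, Monomial.content] at *
    omega

/-! ## Primitive elements and decomposable elements -/

/-- The dot product over `ℚ` is anisotropic, so every subspace of `ℚ^ι` is complemented by its
orthogonal. Over a general `K` of characteristic `0` this can fail, which is why integrality of `Δ`
is needed. -/
theorem exists_mem_span_orthogonal {ι J : Type*} [Fintype ι] (v : J → ι → ℚ) (x : ι → ℚ) :
    ∃ d ∈ Submodule.span ℚ (Set.range v), ∀ j, ∑ a, v j a * (x a - d a) = 0 := by
  classical
  set W := Submodule.span ℚ (Set.range v)
  let B : LinearMap.BilinForm ℚ (ι → ℚ) := dotProductBilin ℚ ℚ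
  have hB : B.IsRefl := by
    intro x y h
    simpa [B, dotProduct_comm] using h
  have hcompl : IsCompl W (B.orthogonal W) := by
    rw [LinearMap.BilinForm.isCompl_orthogonal_iff_disjoint hB, Submodule.disjoint_def]
    intro y hy hy'
    have := hy' y hy
    exact dotProduct_self_eq_zero.mp this
  obtain ⟨d, hd, e, he, hde⟩ := Submodule.mem_sup.mp
    (hcompl.sup_eq_top ▸ Submodule.mem_top : x ∈ W ⊔ B.orthogonal W)
  refine ⟨d, hd, fun j => ?_⟩
  have h2 : B (v j) e = 0 := he _ (Submodule.subset_span ⟨j, rfl⟩)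
  rw [← h2, ← hde]
  simp [B, dotProduct]

theorem cop_eq_pairing (f : FreeAlg P X K) (S S' : Monomial P X) :
    cop P X K f (S, S') = pairing P X K (shuffleMon K S S') f := by
  induction f using Finsupp.induction_linear with
  | zero => simp
  | add x y hx hy => rw [map_add, Finsupp.add_apply, hx, hy, map_add]
  | single T c =>
    have : (Finsupp.single T c : FreeAlg P X K) = c • mon K T := by simp
    rw [this, map_smul, map_smul, pairing_mon_right, Finsupp.smul_apply, shuffleMon_apply]

theorem tensorCoord_tmul (f g : FreeAlg P X K) (S S' : Monomial P X) :
    tensorCoord P X K (f ⊗ₜ[K] g) (S, S') = f S * g S' :=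
  finsuppTensorFinsupp'_apply_apply ..

/-- The counit fixes all coordinates of `Δ(f)` that involve an empty tree. The coordinate at `1 ⊗ 1`
reads `f(1) = 2 f(1)`, and only those at two nonempty trees give further conditions. -/
theorem mem_prim_iff {f : FreeAlg P X K} : f ∈ prim P X K ↔
    f none = 0 ∧ ∀ S S', S ≠ none → S' ≠ none → cop P X K f (S, S') = 0 := by
  rw [mem_prim, ← (tensorCoord P X K).injective.eq_iff, ← cop_apply, map_add]
  constructor
  · intro h
    have h2 : ∀ S S', cop P X K f (S, S') = f S * unit K S' + unit K S * f S' := by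
      intro S S'
      rw [h, Finsupp.add_apply, tensorCoord_tmul, tensorCoord_tmul]
    refine ⟨?_, fun S S' hS hS' => ?_⟩
    · have := h2 none none
      rw [cop_counit] at this
      simpa using this
    · rw [h2]
      simp [hS, hS']
  · rintro ⟨h0, h⟩
    ext ⟨S, S'⟩
    rw [Finsupp.add_apply, tensorCoord_tmul, tensorCoord_tmul]
    by_cases hS : S = none
    · subst hS; rw [cop_counit]; simp [h0]
    · by_cases hS' : S' = none
      · subst hS'; rw [cop_counit']; simp [h0]
      · rw [h S S' hS hS']; simp [hS, hS']

variable (P X K) in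
/-- The span of the shuffle products, of content `c`, of two nontrivial monomials. -/
def decomp (c : Multiset X) : Submodule K (FreeAlg P X K) :=
  Submodule.span K {f | ∃ S S' : Monomial P X, S ≠ none ∧ S' ≠ none ∧
    S.content + S'.content = c ∧ f = shuffleMon K S S'}

theorem pairing_prim_decomp {c : Multiset X} {w d : FreeAlg P X K} (hw : w ∈ prim P X K)
    (hd : d ∈ decomp P X K c) : pairing P X K w d = 0 := by
  rw [decomp] at hd
  induction hd using Submodule.span_induction with
  | mem x hx =>
    obtain ⟨S, S', h1, h2, -, rfl⟩ := hx
    rw [pairing_comm, ← cop_eq_pairing]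
    exact (mem_prim_iff.mp hw).2 S S' h1 h2
  | zero => simp
  | add x y _ _ hx hy => rw [map_add, hx, hy, add_zero]
  | smul r x _ hx => rw [map_smul, hx, smul_zero]

/-- The remaining coordinates of `Δ(f)` are pairings with products `S ⧢ S'`, which vanish
automatically when the contents do not add up to `c`. -/
theorem mem_prim_of_pairing_decomp {c : Multiset X} (hc : c ≠ 0) {f : FreeAlg P X K}
    (hf : f ∈ contentComp P X K c)
    (h : ∀ S S' : Monomial P X, S ≠ none → S' ≠ none → S.content + S'.content = c →
      pairing P X K (shuffleMon K S S') f = 0) : f ∈ prim P X K := by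
  refine mem_prim_iff.mpr ⟨?_, fun S S' hS hS' => ?_⟩
  · by_contra H
    exact hc (mem_contentComp.mp hf none H).symm
  · rw [cop_eq_pairing]
    by_cases hSS : Monomial.content S + Monomial.content S' = c
    · exact h S S' hS hS' hSS
    · by_contra H
      obtain ⟨T, h1, h2⟩ := exists_of_pairing_ne_zero H
      exact hSS ((mem_contentComp.mp (shuffleMon_mem_contentComp S S') T h1).symm.trans
        (mem_contentComp.mp hf T h2))

theorem prim_apply_none {w : FreeAlg P X K} (hw : w ∈ prim P X K) : w none = 0 :=
  (mem_prim_iff.mp hw).1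

/-- Every monomial is the sum of a primitive and a decomposable element. -/
theorem exists_prim_sub_mem_decomp [CharZero K] (T₀ : PRTree P X) :
    ∃ p ∈ prim P X K ⊓ contentComp P X K T₀.content,
      mon K (some T₀) - p ∈ decomp P X K T₀.content := by
  classical
  set c := T₀.content with hc
  have hc0 : c ≠ 0 := by
    intro h
    have := T₀.content_card_pos
    rw [← hc, h] at this
    simp at this
  have hfin : {T : Monomial P X | T.content = c}.Finite :=
    (finite_content_le c).subset fun T hT => le_of_eq hT
  let _ : Fintype {T : Monomial P X | T.content = c} := hfin.fintype
  let J := {q : Monomial P X × Monomial P X //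
    q.1 ≠ none ∧ q.2 ≠ none ∧ q.1.content + q.2.content = c}
  choose n hn using fun (j : J) (T : {T : Monomial P X | T.content = c}) =>
    cop_mon_mem_range_natCast (K := K) T.1 j.1.1 j.1.2
  -- Transport of rational vectors indexed by the trees of content `c`. It carries the integral
  -- vectors `n j` to the products `S ⧢ S'` and the dot product to the form.
  let φ : ({T : Monomial P X | T.content = c} → ℚ) →ₗ[ℚ] FreeAlg P X K :=
    { toFun := fun x => ∑ T, Finsupp.single T.1 (algebraMap ℚ K (x T))
      map_add' := fun x y => by simp [Finset.sum_add_distrib]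
      map_smul' := fun r x => by
        simp only [Pi.smul_apply, smul_eq_mul, map_mul, RingHom.id_apply, Finset.smul_sum,
          Finsupp.smul_single, Algebra.smul_def] }
  have hφ : ∀ x T, φ x T = if h : T.content = c then algebraMap ℚ K (x ⟨T, h⟩) else 0 := by
    intro x T
    simp only [φ, LinearMap.coe_mk, AddHom.coe_mk, Finsupp.finsetSum_apply, Finsupp.single_apply]
    split_ifs with h
    · rw [Finset.sum_eq_single ⟨T, h⟩]
      · simp
      · rintro ⟨U, hU⟩ _ hne
        exact if_neg fun h => hne (Subtype.ext h)
      · simp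
    · refine Finset.sum_eq_zero fun U _ => if_neg ?_
      rintro rfl
      exact h U.2
  have hφc : ∀ x, φ x ∈ contentComp P X K c := by
    intro x
    refine mem_contentComp.mpr fun T hT => ?_
    by_contra H
    rw [hφ, dif_neg H] at hT
    exact hT rfl
  have hφv : ∀ j : J, φ (fun T => (n j T : ℚ)) = shuffleMon K j.1.1 j.1.2 := by
    intro j
    ext T
    rw [hφ]
    split_ifs with h
    · rw [shuffleMon_apply, hn j ⟨T, h⟩]; simp
    · by_contra H
      exact h ((mem_contentComp.mp (shuffleMon_mem_contentComp _ _) T (Ne.symm H)).trans j.2.2.2)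
  have hpair : ∀ x y, pairing P X K (φ x) (φ y) = algebraMap ℚ K (∑ T, x T * y T) := by
    intro x y
    have : φ x = ∑ T, Finsupp.single T.1 (algebraMap ℚ K (x T)) := rfl
    rw [this, map_sum, LinearMap.sum_apply, map_sum]
    refine Finset.sum_congr rfl fun T _ => ?_
    have e1 : (Finsupp.single T.1 (algebraMap ℚ K (x T)) : FreeAlg P X K) =
      algebraMap ℚ K (x T) • mon K T.1 := by simp
    rw [e1, map_smul, LinearMap.smul_apply, pairing_mon_left, hφ, map_mul, smul_eq_mul]
    exact congrArg _ (dif_pos T.2)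
  -- The decomposable part `d` is the orthogonal projection over `ℚ` of the basis vector at `T₀`
  -- onto the span of the vectors `n j`.
  obtain ⟨d, hd, hdo⟩ := exists_mem_span_orthogonal (fun (j : J) T => (n j T : ℚ))
    (Pi.single ⟨some T₀, rfl⟩ 1)
  have hT₀ : φ (Pi.single ⟨some T₀, rfl⟩ 1) = mon K (some T₀) := by
    ext T
    rw [hφ]
    split_ifs with h
    · by_cases hT : T = some T₀
      · subst hT; simp
      · rw [Pi.single_eq_of_ne (fun h => hT (congrArg Subtype.val h)),
          Finsupp.single_eq_of_ne hT, map_zero]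
    · rw [Finsupp.single_eq_of_ne]
      rintro rfl
      exact h rfl
  refine ⟨mon K (some T₀) - φ d, ⟨?_, ?_⟩, ?_⟩
  · rw [← hT₀, ← map_sub]
    refine mem_prim_of_pairing_decomp hc0 (hφc _) fun S S' hS hS' hSS => ?_
    have := hφv ⟨(S, S'), hS, hS', hSS⟩
    rw [← this, hpair]
    rw [← map_zero (algebraMap ℚ K)]
    exact congrArg _ (hdo ⟨(S, S'), hS, hS', hSS⟩)
  · rw [← hT₀, ← map_sub]
    exact hφc _
  · rw [sub_sub_cancel]
    clear hdo
    induction hd using Submodule.span_induction with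
    | mem x hx =>
      obtain ⟨j, rfl⟩ := hx
      rw [hφv]
      exact Submodule.subset_span ⟨_, _, j.2.1, j.2.2.1, j.2.2.2, rfl⟩
    | zero => rw [map_zero]; exact zero_mem _
    | add x y _ _ hx hy => rw [map_add]; exact add_mem hx hy
    | smul r x _ hx =>
      have : φ (r • x) = algebraMap ℚ K r • φ x := by rw [map_smul, algebraMap_smul]
      rw [this]
      exact Submodule.smul_mem _ _ hx

variable (K) in
/-- The component in `Prim A` of a nonempty tree. -/
def primPart [CharZero K] (T : PRTree P X) : FreeAlg P X K :=
  (exists_prim_sub_mem_decomp (K := K) T).choose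

section
variable [CharZero K]

theorem primPart_mem_prim (T : PRTree P X) : primPart K T ∈ prim P X K :=
  (exists_prim_sub_mem_decomp (K := K) T).choose_spec.1.1

theorem primPart_mem_contentComp (T : PRTree P X) : primPart K T ∈ contentComp P X K T.content :=
  (exists_prim_sub_mem_decomp (K := K) T).choose_spec.1.2

theorem mon_sub_primPart_mem_decomp (T : PRTree P X) :
    mon K (some T) - primPart K T ∈ decomp P X K T.content :=
  (exists_prim_sub_mem_decomp (K := K) T).choose_spec.2

theorem primPart_mem_primHomog (T : PRTree P X) :
    primPart K T ∈ primHomog P X K (Multiset.card T.content) :=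
  ⟨primPart_mem_prim T, contentComp_le_homog _ (primPart_mem_contentComp T)⟩

/-- The bilinear form is nondegenerate on `Prim A`. -/
theorem prim_eq_zero_of_pairing {w : FreeAlg P X K} (hw : w ∈ prim P X K)
    (h : ∀ T, w (some T) ≠ 0 → pairing P X K w (primPart K T) = 0) : w = 0 := by
  ext T
  cases T with
  | none => simpa using prim_apply_none hw
  | some T =>
    by_contra H
    -- A primitive `w` does not see the decomposable part of `T`, so its coefficient at `T` equals
    -- `⟨w, primPart K T⟩`.
    have h1 := pairing_prim_decomp hw (mon_sub_primPart_mem_decomp T)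
    rw [map_sub, pairing_mon_right, h T H, sub_zero] at h1
    exact H h1

theorem primHomog_eq_zero_of_pairing {n : ℕ} {w : FreeAlg P X K} (hw : w ∈ primHomog P X K n)
    (h : ∀ u ∈ primHomog P X K n, pairing P X K w u = 0) : w = 0 := by
  refine prim_eq_zero_of_pairing hw.1 fun T hT => h _ ?_
  have := mem_homog.mp hw.2 _ hT
  rw [← this]
  exact primPart_mem_primHomog T

/-- The difference of the two sides is a primitive element and also a sum of decomposable ones. It
is therefore orthogonal to `Prim A`, and nondegeneracy kills it. -/
theorem prim_eq_sum_primPart {w : FreeAlg P X K} (hw : w ∈ prim P X K) :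
    w = w.sum fun T r => r • T.elim 0 (primPart K) := by
  have hmem : ∀ T : Monomial P X, T.elim 0 (primPart K) ∈ prim P X K := by
    intro T
    cases T with
    | none => exact zero_mem _
    | some T => exact primPart_mem_prim T
  have hs : (w.sum fun T r => r • T.elim 0 (primPart K)) ∈ prim P X K :=
    sum_mem fun T _ => Submodule.smul_mem _ _ (hmem T)
  rw [← sub_eq_zero]
  have hw' : w = w.sum fun T r => r • mon K T := by
    simp
  have hd : ∀ u ∈ prim P X K,
      pairing P X K u (w - w.sum fun T r => r • T.elim 0 (primPart K)) = 0 := by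
    intro u hu
    nth_rw 1 [hw']
    rw [← Finsupp.sum_sub, Finsupp.sum, map_sum]
    refine Finset.sum_eq_zero fun T hT => ?_
    cases T with
    | none => exact absurd (prim_apply_none hw) (Finsupp.mem_support_iff.mp hT)
    | some T =>
      rw [← smul_sub, map_smul, Option.elim_some,
        pairing_prim_decomp hu (mon_sub_primPart_mem_decomp T), smul_zero]
  refine prim_eq_zero_of_pairing (sub_mem hw hs) fun T _ => ?_
  rw [pairing_comm]
  exact hd _ (primPart_mem_prim T)

theorem prim_eq_span : prim P X K = Submodule.span K (Set.range (primPart K)) := by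
  refine le_antisymm (fun w hw => ?_) ?_
  · rw [prim_eq_sum_primPart hw]
    refine sum_mem fun T _ => Submodule.smul_mem _ _ ?_
    cases T with
    | none => exact zero_mem _
    | some T => exact Submodule.subset_span ⟨T, rfl⟩
  · rw [Submodule.span_le]
    rintro _ ⟨T, rfl⟩
    exact primPart_mem_prim T

theorem prim_eq_iSup : prim P X K = ⨆ n : ℕ, primHomog P X K n := by
  refine le_antisymm ?_ (iSup_le fun n => inf_le_left)
  rw [prim_eq_span, Submodule.span_le]
  rintro _ ⟨T, rfl⟩
  exact Submodule.mem_iSup_of_mem _ (primPart_mem_primHomog T)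

end

/-! ## Algebraic independence of primitive elements -/

section Independence

open MvPolynomial

variable {ι : Type*}

/-- Both sides are values at `p` of derivations along the evaluation map, and they agree on the
variables of `p` by `graftAdj_of_homog`. So the derivation of `w` acts as the derivative in the
direction `(⟨f j, w⟩)`. -/
theorem primDerivation_aeval {n : ℕ} {f : ι → FreeAlg P X K} {d : ι → ℕ}
    (hf : ∀ i, f i ∈ homog P X K (d i)) (w : prim P X K) (hw : w.1 ∈ homog P X K n)
    (p : MvPolynomial ι K) (hp : ∀ j ∈ p.vars, d j ≤ n) :
    primDerivation w (aeval (fun i => toShuffle (f i)) p) =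
      aeval (fun i => toShuffle (f i)) (∑ j ∈ p.vars, pairing P X K (f j) w.1 • pderiv j p) := by
  classical
  set φ : MvPolynomial ι K →ₐ[K] ShuffleAlg P X K := aeval fun i => toShuffle (f i) with hφ
  -- Evaluation makes the shuffle algebra a module over the polynomial ring, so that both composites
  -- become derivations of that ring.
  let _ : Algebra (MvPolynomial ι K) (ShuffleAlg P X K) := φ.toRingHom.toAlgebra
  have : IsScalarTower K (MvPolynomial ι K) (ShuffleAlg P X K) :=
    IsScalarTower.of_algebraMap_eq' φ.comp_algebraMap.symm
  let D₁ : Derivation K (MvPolynomial ι K) (ShuffleAlg P X K) :=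
    (primDerivation w).compAlgebraMap (MvPolynomial ι K)
  let E : Derivation K (MvPolynomial ι K) (MvPolynomial ι K) :=
    ∑ j ∈ p.vars, pairing P X K (f j) w.1 • pderiv j
  let D₂ : Derivation K (MvPolynomial ι K) (ShuffleAlg P X K) :=
    (Algebra.linearMap (MvPolynomial ι K) (ShuffleAlg P X K)).compDer E
  have hE : ∀ q, E q = ∑ j ∈ p.vars, pairing P X K (f j) w.1 • pderiv j q := by
    intro q
    have : E q = Derivation.coeFnAddMonoidHom E q := rfl
    rw [this, map_sum, Finset.sum_apply]
    rfl
  have h : D₁ p = D₂ p := by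
    refine derivation_eq_of_forall_mem_vars fun i hi => ?_
    have e1 : D₁ (MvPolynomial.X i) = primDerivation w (φ (MvPolynomial.X i)) := rfl
    have e2 : D₂ (MvPolynomial.X i) = φ (E (MvPolynomial.X i)) := rfl
    rw [e1, e2, hE, Finset.sum_eq_single i]
    · rw [pderiv_X_self, hφ, aeval_X, primDerivation_toShuffle,
        graftAdj_of_homog hw (hf i) (hp i hi), map_smul, map_smul, map_one, toShuffle_unit]
    · intro j _ hj
      rw [pderiv_X_of_ne hj.symm, smul_zero]
    · intro h
      exact absurd hi h
  have e2 : D₂ p = φ (E p) := rfl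
  rw [← hE, ← e2, ← h]
  rfl

theorem primHomog_zero : primHomog P X K 0 = ⊥ := by
  rw [eq_bot_iff]
  intro f hf
  rw [Submodule.mem_bot]
  ext T
  by_contra H
  have := (degree_eq_zero_iff T).mp (mem_homog.mp hf.2 T H)
  subst this
  exact H (prim_apply_none hf.1)

theorem homog_apply_none {f : FreeAlg P X K} {n : ℕ} (hf : f ∈ homog P X K n) (hn : n ≠ 0) :
    f none = 0 := by
  by_contra H
  exact hn (mem_homog.mp hf none H).symm

theorem toShuffle_one_ne_zero : (1 : ShuffleAlg P X K) ≠ 0 := by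
  rw [← toShuffle_unit, Ne, LinearEquiv.map_eq_zero_iff, Finsupp.single_eq_zero]
  exact one_ne_zero

variable [CharZero K]

/-- Linearly independent homogeneous primitive elements are algebraically independent in the
shuffle algebra. -/
theorem aeval_injective {f : ι → FreeAlg P X K} {d : ι → ℕ}
    (hf : ∀ i, f i ∈ primHomog P X K (d i)) (hli : LinearIndependent K f) :
    Function.Injective (aeval (R := K) fun i => toShuffle (f i)) := by
  classical
  set φ : MvPolynomial ι K →ₐ[K] ShuffleAlg P X K := aeval fun i => toShuffle (f i) with hφ
  have hd : ∀ i, d i ≠ 0 := by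
    intro i h
    have := hf i
    rw [h, primHomog_zero, Submodule.mem_bot] at this
    exact hli.ne_zero i this
  have hconst : ∀ p : MvPolynomial ι K, (∀ m ∈ p.support, m = 0) → φ p = 0 → p = 0 := by
    intro p hp h
    have : p = C (coeff 0 p) := by
      ext m
      rw [coeff_C]
      split_ifs with hm
      · rw [hm]
      · by_contra H
        exact hm (hp m (mem_support_iff.mpr H)).symm
    rw [this, algHom_C, Algebra.algebraMap_eq_smul_one, smul_eq_zero] at h
    rw [this, h.resolve_right toShuffle_one_ne_zero, C_0]
  -- Double induction: the outer parameter `n` bounds the degrees of the generators that occur, the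
  -- inner `N` the total degree of the polynomial.
  have main : ∀ n N : ℕ, ∀ p : MvPolynomial ι K,
      (∀ m ∈ p.support, m.degree ≤ N ∧ ∀ j ∈ m.support, d j ≤ n) → φ p = 0 → p = 0 := by
    intro n
    induction n with
    | zero =>
      intro N p hp h
      refine hconst p (fun m hm => ?_) h
      rw [← Finsupp.support_eq_empty, Finset.eq_empty_iff_forall_notMem]
      intro j hj
      exact hd j (Nat.le_zero.mp ((hp m hm).2 j hj))
    | succ n ihn =>
      intro N
      induction N with
      | zero =>
        intro p hp h
        refine hconst p (fun m hm => ?_) h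
        exact (Finsupp.degree_eq_zero_iff m).mp (Nat.le_zero.mp (hp m hm).1)
      | succ N ihN =>
        intro p hp h
        have hvars : ∀ j ∈ p.vars, d j ≤ n + 1 := by
          intro j hj
          obtain ⟨m, hm, hjm⟩ := (mem_vars_iff_mem_support j).mp hj
          exact (hp m hm).2 j hjm
        have hpd : ∀ j, d j = n + 1 → pderiv j p = 0 := by
          have hq : ∀ w ∈ primHomog P X K (n + 1),
              ∑ j ∈ p.vars, pairing P X K (f j) w • pderiv j p = 0 := by
            intro w hw
            -- Each term of the directional derivative has lost one factor, and evaluation sends the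
            -- sum to the derivation of `w` applied to `φ p = 0`.
            refine ihN _ (fun m hm => ?_) ?_
            · rw [mem_support_iff, coeff_sum] at hm
              obtain ⟨j, -, hj⟩ := Finset.exists_ne_zero_of_sum_ne_zero hm
              rw [coeff_smul, coeff_pderiv] at hj
              have h1 := hp _ (mem_support_iff.mpr
                (left_ne_zero_of_mul (right_ne_zero_of_smul hj)))
              rw [map_add, Finsupp.degree_single] at h1
              refine ⟨by omega, fun i hi => h1.2 i ?_⟩
              rw [Finsupp.mem_support_iff] at hi ⊢
              rw [Finsupp.add_apply]
              omega
            · have := primDerivation_aeval (fun i => (hf i).2) ⟨w, hw.1⟩ hw.2 p hvars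
              rw [← hφ, h, map_zero] at this
              exact this.symm
          intro j hj
          by_cases hjv : j ∉ p.vars
          · exact pderiv_eq_zero_of_notMem_vars hjv
          push Not at hjv
          ext m
          -- For a fixed exponent `m`, the coefficients of the partial derivatives assemble to one
          -- primitive element of degree `n + 1`. It is orthogonal to all primitives of that degree,
          -- hence zero, and linear independence applies.
          have hg : ∑ j ∈ p.vars with d j = n + 1, coeff m (pderiv j p) • f j = 0 := by
            refine primHomog_eq_zero_of_pairing (n := n + 1)
              (sum_mem fun i hi => Submodule.smul_mem _ _ ?_) fun w hw => ?_
            · rw [← (Finset.mem_filter.mp hi).2]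
              exact hf i
            · have h1 := congrArg (coeff m) (hq w hw)
              rw [coeff_sum, coeff_zero] at h1
              rw [map_sum, LinearMap.sum_apply, ← h1, Finset.sum_filter]
              refine Finset.sum_congr rfl fun i _ => ?_
              rw [coeff_smul, map_smul, LinearMap.smul_apply, smul_eq_mul, smul_eq_mul, mul_comm]
              split_ifs with hi
              · rfl
              · rw [pairing_eq_zero_of_homog hi (hf i).2 hw.2, zero_mul]
          have := linearIndependent_iff'.mp hli _ _ hg j
            (Finset.mem_filter.mpr ⟨hjv, hj⟩)
          rw [this, coeff_zero]
        refine ihn (N + 1) p (fun m hm => ⟨(hp m hm).1, fun j hj => ?_⟩) h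
        by_contra H
        have hj1 : d j = n + 1 := le_antisymm ((hp m hm).2 j hj) (by omega)
        -- This coefficient of the derivative is the coefficient of `p` at `m` times the positive
        -- multiplicity of `j` in `m`, which is nonzero in characteristic `0`.
        have h1 := congrArg (coeff (m - Finsupp.single j 1)) (hpd j hj1)
        have h2 : Finsupp.single j 1 ≤ m := by
          rw [Finsupp.single_le_iff]
          exact Nat.one_le_iff_ne_zero.mpr (Finsupp.mem_support_iff.mp hj)
        rw [coeff_pderiv, coeff_zero, tsub_add_cancel_of_le h2] at h1
        rcases mul_eq_zero.mp h1 with h3 | h3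
        · exact mem_support_iff.mp hm h3
        · exact Nat.cast_add_one_ne_zero _ h3
  rw [injective_iff_map_eq_zero]
  intro p hp
  refine main (p.vars.sup d) (p.support.sup Finsupp.degree) p (fun m hm => ⟨?_, fun j hj => ?_⟩) hp
  · exact Finset.le_sup (f := fun m : ι →₀ ℕ => m.degree) hm
  · exact Finset.le_sup (f := d) ((mem_vars_iff_mem_support j).mpr ⟨m, hm, hj⟩)

end Independence

/-! ## Generation by primitive elements -/

section Generation

open MvPolynomial

variable {ι M : Type*} [AddCommMonoid M]

variable (P K) in
/-- The component of degree `γ` with respect to the grading given by a function `θ` of the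
content. -/
def gradedComp (θ : Multiset X →+ M) (γ : M) : Submodule K (FreeAlg P X K) :=
  Finsupp.supported K K {m | θ m.content = γ}

theorem mem_gradedComp {θ : Multiset X →+ M} {γ : M} {f : FreeAlg P X K} :
    f ∈ gradedComp P K θ γ ↔ ∀ T, f T ≠ 0 → θ T.content = γ := by
  rw [gradedComp, Finsupp.mem_supported']
  exact forall_congr' fun T => not_imp_comm

theorem contentComp_le_gradedComp (θ : Multiset X →+ M) (c : Multiset X) :
    contentComp P X K c ≤ gradedComp P K θ (θ c) := fun _ hf =>
  mem_gradedComp.mpr fun _ hT => congrArg θ (mem_contentComp.mp hf _ hT)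

theorem shuffle_mem_gradedComp {θ : Multiset X →+ M} {c d : M} {f g : FreeAlg P X K}
    (hf : f ∈ gradedComp P K θ c) (hg : g ∈ gradedComp P K θ d) :
    shuffle P X K f g ∈ gradedComp P K θ (c + d) := by
  rw [shuffle, Finsupp.linearCombination_apply, Finsupp.sum, LinearMap.sum_apply]
  refine sum_mem fun S hS => ?_
  rw [LinearMap.smul_apply, Finsupp.linearCombination_apply, Finsupp.sum]
  refine Submodule.smul_mem _ _ (sum_mem fun S' hS' => Submodule.smul_mem _ _ ?_)
  rw [← mem_gradedComp.mp hf S (Finsupp.mem_support_iff.mp hS),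
    ← mem_gradedComp.mp hg S' (Finsupp.mem_support_iff.mp hS'), ← map_add]
  exact contentComp_le_gradedComp θ _ (shuffleMon_mem_contentComp S S')

theorem unit_mem_gradedComp (θ : Multiset X →+ M) : unit K ∈ gradedComp P K θ 0 := by
  rw [← map_zero θ]
  exact contentComp_le_gradedComp θ _ (mon_mem_contentComp none)

variable {θ : Multiset X →+ M} {f : ι → FreeAlg P X K} {w : ι → M}

theorem aeval_monomial_mem_gradedComp (hf : ∀ i, f i ∈ gradedComp P K θ (w i)) (m : ι →₀ ℕ) :
    aeval (fun i => toShuffle (f i)) (monomial m (1 : K)) ∈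
      (gradedComp P K θ (Finsupp.weight w m)).map toShuffle.toLinearMap := by
  induction m using Finsupp.induction_linear with
  | zero =>
    rw [map_zero, monomial_zero', map_one, map_one]
    exact ⟨unit K, unit_mem_gradedComp θ, rfl⟩
  | add m m' hm hm' =>
    obtain ⟨a, ha, ha'⟩ := hm
    obtain ⟨b, hb, hb'⟩ := hm'
    rw [map_add, ← one_mul (1 : K), ← monomial_mul, map_mul, ← ha', ← hb']
    exact ⟨_, shuffle_mem_gradedComp ha hb, rfl⟩
  | single i n =>
    induction n with
    | zero =>
      rw [Finsupp.single_zero, map_zero, monomial_zero', map_one, map_one]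
      exact ⟨unit K, unit_mem_gradedComp θ, rfl⟩
    | succ n ih =>
      obtain ⟨a, ha, ha'⟩ := ih
      rw [Finsupp.single_add, map_add, ← one_mul (1 : K), ← monomial_mul, map_mul, ← ha',
        aeval_monomial]
      refine ⟨_, shuffle_mem_gradedComp ha (?_ : f i ∈ _), ?_⟩
      · rw [Finsupp.weight_single, one_smul]
        exact hf i
      · simp [toShuffle_shuffle]

theorem map_aeval_le_gradedComp (hf : ∀ i, f i ∈ gradedComp P K θ (w i)) (γ : M) :
    (weightedHomogeneousSubmodule K w γ).map (aeval fun i => toShuffle (f i)).toLinearMap ≤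
      (gradedComp P K θ γ).map toShuffle.toLinearMap := by
  rintro _ ⟨p, hp, rfl⟩
  rw [← support_sum_monomial_coeff p, map_sum]
  refine sum_mem fun m hm => ?_
  have h1 : monomial m (coeff m p) = coeff m p • monomial m (1 : K) := by
    rw [smul_monomial, smul_eq_mul, mul_one]
  have h2 : Finsupp.weight w m = γ := hp (mem_support_iff.mp hm)
  rw [h1, map_smul, ← h2]
  exact Submodule.smul_mem _ _ (aeval_monomial_mem_gradedComp hf m)

/-- Generators of another degree are supported on other trees, so in any expression of `x` their
total contribution is zero and can be dropped. -/
theorem mem_span_image_of_mem_gradedComp (hf : ∀ i, f i ∈ gradedComp P K θ (w i)) {γ : M}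
    {x : FreeAlg P X K} (hx : x ∈ gradedComp P K θ γ)
    (hxs : x ∈ Submodule.span K (Set.range f)) :
    x ∈ Submodule.span K (f '' {i | w i = γ}) := by
  classical
  obtain ⟨c, rfl⟩ := Finsupp.mem_span_range_iff_exists_finsupp.mp hxs
  have h1 : (c.sum fun i a => a • f i) = ∑ i ∈ c.support with w i = γ, c i • f i := by
    rw [Finsupp.sum, Finset.sum_filter]
    ext T
    rw [Finsupp.finsetSum_apply, Finsupp.finsetSum_apply]
    by_cases hT : θ T.content = γ
    · refine Finset.sum_congr rfl fun i _ => ?_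
      split_ifs with hi
      · rfl
      · have : f i T = 0 := by
          by_contra H
          exact hi ((mem_gradedComp.mp (hf i) T H).symm.trans hT)
        simp [this]
    · have h2 : ∑ i ∈ c.support, (c i • f i) T = 0 := by
        by_contra H
        refine hT (mem_gradedComp.mp hx T ?_)
        rwa [Finsupp.sum, Finsupp.finsetSum_apply]
      rw [h2]
      refine (Finset.sum_eq_zero fun i _ => ?_).symm
      split_ifs with hi
      · have : f i T = 0 := by
          by_contra H
          exact hT ((mem_gradedComp.mp (hf i) T H).trans hi)
        simp [this]
      · rfl
  rw [h1]
  exact sum_mem fun i hi => Submodule.smul_mem _ _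
    (Submodule.subset_span ⟨i, (Finset.mem_filter.mp hi).2, rfl⟩)

theorem toShuffle_mem_map_of_mem_span (hf : ∀ i, f i ∈ gradedComp P K θ (w i)) {γ : M}
    {x : FreeAlg P X K} (hx : x ∈ gradedComp P K θ γ)
    (hxs : x ∈ Submodule.span K (Set.range f)) :
    toShuffle x ∈
      (weightedHomogeneousSubmodule K w γ).map (aeval fun i => toShuffle (f i)).toLinearMap := by
  have hle : Submodule.span K (f '' {i | w i = γ}) ≤ ((weightedHomogeneousSubmodule K w γ).map
      (aeval fun i => toShuffle (f i)).toLinearMap).comap toShuffle.toLinearMap := by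
    rw [Submodule.span_le]
    rintro _ ⟨i, rfl, rfl⟩
    exact ⟨MvPolynomial.X i, isWeightedHomogeneous_X K w i, by simp⟩
  exact hle (mem_span_image_of_mem_gradedComp hf hx hxs)

variable {φ : MvPolynomial ι K →ₐ[K] ShuffleAlg P X K}

/-- Both factors of a decomposable product of degree at most `N + 1` are nonempty, so each has
degree at most `N` and its polynomial is already available. -/
theorem decomp_mem_map {N : ℕ}
    (h : ∀ T : Monomial P X, T.degree ≤ N →
      toShuffle (mon K T) ∈ (weightedHomogeneousSubmodule K w (θ T.content)).map φ.toLinearMap)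
    {c : Multiset X} (hc : Multiset.card c ≤ N + 1) {x : FreeAlg P X K} (hx : x ∈ decomp P X K c) :
    toShuffle x ∈ (weightedHomogeneousSubmodule K w (θ c)).map φ.toLinearMap := by
  have hle : decomp P X K c ≤ ((weightedHomogeneousSubmodule K w (θ c)).map φ.toLinearMap).comap
      toShuffle.toLinearMap := by
    rw [decomp, Submodule.span_le]
    rintro _ ⟨S, S', hS, hS', rfl, rfl⟩
    have h1 := Nat.pos_of_ne_zero fun h => hS ((degree_eq_zero_iff S).mp h)
    have h2 := Nat.pos_of_ne_zero fun h => hS' ((degree_eq_zero_iff S').mp h)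
    rw [Multiset.card_add] at hc
    simp only [Monomial.degree] at h1 h2
    obtain ⟨p, hp, hp'⟩ := h S (by simp only [Monomial.degree]; omega)
    obtain ⟨q, hq, hq'⟩ := h S' (by simp only [Monomial.degree]; omega)
    refine ⟨p * q, ?_, ?_⟩
    · rw [map_add]
      exact IsWeightedHomogeneous.mul hp hq
    · rw [LinearEquiv.coe_coe, ← shuffle_mon_mon, toShuffle_shuffle, ← hp', ← hq']
      exact map_mul φ p q
  exact hle hx

/-- Induction on the degree, splitting a tree into its primitive part and a decomposable element.
The bound `N` matters for part (iii), where only generators of degree below `n` are present. -/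
theorem mon_mem_map [CharZero K] {N : ℕ}
    (h : ∀ T : PRTree P X, Multiset.card T.content ≤ N → toShuffle (primPart K T) ∈
      (weightedHomogeneousSubmodule K w (θ T.content)).map φ.toLinearMap) :
    ∀ T : Monomial P X, T.degree ≤ N → toShuffle (mon K T) ∈
      (weightedHomogeneousSubmodule K w (θ T.content)).map φ.toLinearMap := by
  induction N with
  | zero =>
    intro T hT
    rw [(degree_eq_zero_iff T).mp (Nat.le_zero.mp hT)]
    refine ⟨1, ?_, map_one φ⟩
    have : θ (Monomial.content (none : Monomial P X)) = 0 := map_zero θ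
    rw [this]
    exact isWeightedHomogeneous_one K w
  | succ N ih =>
    intro T hT
    cases T with
    | none => exact ih (fun T hT => h T (hT.trans N.le_succ)) none (Nat.zero_le _)
    | some T =>
      have h1 := decomp_mem_map (ih fun T hT => h T (hT.trans N.le_succ)) hT
        (mon_sub_primPart_mem_decomp (K := K) T)
      rw [← sub_add_cancel (mon K (some T)) (primPart K T), map_add]
      exact add_mem h1 (h T hT)

end Generation

/-! ## The shuffle algebra as a symmetric algebra -/

section Symmetric

open MvPolynomial

variable [CharZero K]

variable (P X K) in
-- Choosing the basis among the primitive parts of trees makes it homogeneous not only for the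
-- degree but for the content.
theorem exists_basis_prim : ∃ (κ : Type u) (T : κ → PRTree P X),
    LinearIndependent K (fun i => primPart K (T i)) ∧
    Submodule.span K (Set.range fun i => primPart K (T i)) = prim P X K := by
  obtain ⟨κ, a, -, h1, h2⟩ := exists_linearIndependent' K (primPart K : PRTree P X → _)
  exact ⟨κ, a, h2, h1.trans prim_eq_span.symm⟩

/-- This is the generation statement refined by content. Surjectivity and the dimension count in
(ii) both rest on it. -/
theorem gradedComp_eq_map_aeval {κ : Type*} {T : κ → PRTree P X}
    (hs : Submodule.span K (Set.range fun i => primPart K (T i)) = prim P X K) (c : Multiset X) :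
    (weightedHomogeneousSubmodule K (fun i => (T i).content) c).map
      (aeval fun i => toShuffle (primPart K (T i))).toLinearMap =
      (contentComp P X K c).map toShuffle.toLinearMap := by
  refine le_antisymm ?_ ?_
  · exact map_aeval_le_gradedComp (θ := AddMonoidHom.id _)
      (fun i => primPart_mem_contentComp (T i)) c
  · rintro _ ⟨x, hx, rfl⟩
    rw [LinearEquiv.coe_coe, ← Finsupp.sum_single x, Finsupp.sum, map_sum]
    refine sum_mem fun S hS => ?_
    have e1 : (Finsupp.single S (x S) : FreeAlg P X K) = x S • mon K S := by simp
    rw [e1, map_smul, ← mem_contentComp.mp hx S (Finsupp.mem_support_iff.mp hS)]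
    refine Submodule.smul_mem _ _ (mon_mem_map (θ := AddMonoidHom.id _) (N := S.degree)
      (fun U _ => ?_) S le_rfl)
    refine toShuffle_mem_map_of_mem_span (θ := AddMonoidHom.id _)
      (fun i => primPart_mem_contentComp (T i)) (primPart_mem_contentComp U) ?_
    rw [hs]
    exact primPart_mem_prim U

theorem aeval_bijective {κ : Type*} {T : κ → PRTree P X}
    (hli : LinearIndependent K fun i => primPart K (T i))
    (hs : Submodule.span K (Set.range fun i => primPart K (T i)) = prim P X K) :
    Function.Bijective (aeval (R := K) fun i => toShuffle (primPart K (T i))) := by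
  refine ⟨aeval_injective (fun i => primPart_mem_primHomog (T i)) hli, ?_⟩
  rw [← AlgHom.coe_toLinearMap, ← LinearMap.range_eq_top, eq_top_iff]
  rintro x -
  obtain ⟨x, rfl⟩ := toShuffle.surjective x
  rw [← Finsupp.sum_single x, Finsupp.sum, map_sum]
  refine sum_mem fun S hS => ?_
  have h1 : toShuffle (Finsupp.single S (x S)) ∈
      (contentComp P X K S.content).map toShuffle.toLinearMap := by
    refine ⟨_, ?_, rfl⟩
    have e1 : (Finsupp.single S (x S) : FreeAlg P X K) = x S • mon K S := by simp
    rw [e1]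
    exact Submodule.smul_mem _ _ (mon_mem_contentComp S)
  rw [← gradedComp_eq_map_aeval hs] at h1
  exact LinearMap.map_le_range h1

variable (P X K) in
/-- The shuffle algebra is the symmetric algebra on the primitive elements. -/
theorem exists_symmetricAlgebra_equiv :
    ∃ φ : SymmetricAlgebra K (prim P X K) ≃ₗ[K] FreeAlg P X K,
      φ 1 = unit K ∧
      (∀ a b, φ (a * b) = shuffle P X K (φ a) (φ b)) ∧
      ∀ w : prim P X K, φ (SymmetricAlgebra.ι K (prim P X K) w) = (w : FreeAlg P X K) := by
  obtain ⟨κ, T, hli, hs⟩ := exists_basis_prim P X K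
  let v : κ → prim P X K := fun i => ⟨primPart K (T i), primPart_mem_prim (T i)⟩
  have hv : LinearIndependent K v := LinearIndependent.of_comp (prim P X K).subtype hli
  have hvs : ⊤ ≤ Submodule.span K (Set.range v) := by
    rintro ⟨x, hx⟩ -
    rw [← hs] at hx
    obtain ⟨c, hc⟩ := Finsupp.mem_span_range_iff_exists_finsupp.mp hx
    refine Finsupp.mem_span_range_iff_exists_finsupp.mpr ⟨c, Subtype.ext ?_⟩
    refine Eq.trans ?_ hc
    rw [← Submodule.subtype_apply, Finsupp.sum, map_sum]
    rfl
  let b := Module.Basis.mk hv hvs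
  let e := (SymmetricAlgebra.equivMvPolynomial b).trans
    (AlgEquiv.ofBijective _ (aeval_bijective hli hs))
  refine ⟨e.toLinearEquiv.trans toShuffle.symm, ?_, fun x y => ?_, fun w => ?_⟩
  · exact congrArg toShuffle.symm (map_one e)
  · exact congrArg toShuffle.symm (map_mul e x y)
  · have : (e.toLinearEquiv.trans toShuffle.symm).toLinearMap ∘ₗ SymmetricAlgebra.ι K (prim P X K) =
        (prim P X K).subtype := by
      refine b.ext fun i => ?_
      have h1 : e (SymmetricAlgebra.ι K _ (b i)) = toShuffle (primPart K (T i)) := by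
        simp [e]
      have h2 : (b i : FreeAlg P X K) = primPart K (T i) := by simp [b, v]
      rw [Submodule.subtype_apply, h2]
      exact congrArg toShuffle.symm h1
    exact congrArg (fun F => F w) this

end Symmetric

/-! ## Bases of the orthogonal complements -/

section Complement

open MvPolynomial

/-- The form pairs `f ⊗ g` with `w ⊗ 1 + 1 ⊗ w`, and each summand pairs `g` or `f` with `1`. -/
theorem pairing_prim_shuffle {w f g : FreeAlg P X K} (hw : w ∈ prim P X K) (hf : f none = 0)
    (hg : g none = 0) : pairing P X K w (shuffle P X K f g) = 0 := by
  rw [pairing_comm, pairing_shuffle, mem_prim.mp hw]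
  simp [pairing_mon_right, hf, hg]

theorem weightedHomogeneousSubmodule_eq_span {σ M : Type*} [AddCommMonoid M] (w : σ → M) (γ : M) :
    weightedHomogeneousSubmodule K w γ =
      Submodule.span K ((fun m => monomial m (1 : K)) '' {m | Finsupp.weight w m = γ}) := by
  refine le_antisymm (fun p hp => ?_) ?_
  · rw [← support_sum_monomial_coeff p]
    refine sum_mem fun m hm => ?_
    have h1 : monomial m (coeff m p) = coeff m p • monomial m (1 : K) := by
      rw [smul_monomial, smul_eq_mul, mul_one]
    rw [h1]
    exact Submodule.smul_mem _ _ (Submodule.subset_span ⟨m, hp (mem_support_iff.mp hm), rfl⟩)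
  · rw [Submodule.span_le]
    rintro _ ⟨m, hm, rfl⟩
    exact isWeightedHomogeneous_monomial w m 1 hm

theorem linearIndependent_monomial (σ : Type*) :
    LinearIndependent K fun m : σ →₀ ℕ => monomial m (1 : K) := by
  have := (basisMonomials σ K).linearIndependent
  rwa [coe_basisMonomials] at this

theorem toShuffle_shuffleList_map {ι : Type*} [DecidableEq ι] (f : ι → FreeAlg P X K) (l : List ι) :
    toShuffle (shuffleList K (l.map f)) =
      aeval (fun i => toShuffle (f i)) (monomial (Multiset.toFinsupp (l : Multiset ι)) (1 : K)) := by
  induction l with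
  | nil => simp [toShuffle_shuffleList]
  | cons i l ih =>
    have h1 : Multiset.toFinsupp ((i :: l : List ι) : Multiset ι) =
        Finsupp.single i 1 + Multiset.toFinsupp (l : Multiset ι) := by
      rw [← Multiset.cons_coe, ← Multiset.singleton_add, map_add, Multiset.toFinsupp_singleton]
    rw [h1, ← one_mul (1 : K), ← monomial_mul, map_mul, ← ih, aeval_monomial]
    simp [toShuffle_shuffleList]

theorem weight_toFinsupp {ι : Type*} [DecidableEq ι] {M : Type*} [AddCommMonoid M] (d : ι → M) (l : List ι) :
    Finsupp.weight d (Multiset.toFinsupp (l : Multiset ι)) = (l.map d).sum := by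
  induction l with
  | nil => simp
  | cons i l ih =>
    rw [← Multiset.cons_coe, ← Multiset.singleton_add, map_add, map_add, ih,
      Multiset.toFinsupp_singleton, Finsupp.weight_single, one_smul, List.map_cons, List.sum_cons]

theorem shuffleList_map_mem_homog {ι : Type*} {f : ι → FreeAlg P X K} {d : ι → ℕ}
    (hf : ∀ i, f i ∈ homog P X K (d i)) (l : List ι) :
    shuffleList K (l.map f) ∈ homog P X K (l.map d).sum := by
  induction l with
  | nil => exact unit_mem_gradedComp (P := P) (K := K) (Multiset.cardHom (α := X))
  | cons i l ih => exact shuffle_mem_gradedComp (θ := Multiset.cardHom (α := X)) (hf i) ih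

variable [CharZero K]

/-- Sorted lists correspond to exponent vectors, so independence is injectivity of the evaluation
map. Spanning follows since modulo these products every tree of degree `n` is primitive, and a
primitive element orthogonal to all primitives of its degree vanishes. -/
theorem sorted_shuffleList_basis {n : ℕ} (hn : 2 ≤ n) {ι : Type*} [LinearOrder ι]
    (f : ι → FreeAlg P X K) (d : ι → ℕ) (hd : ∀ i, f i ∈ homog P X K (d i))
    (hli : LinearIndependent K f)
    (hs : Submodule.span K (Set.range f) = ⨆ k ∈ Finset.Icc 1 (n - 1), primHomog P X K k) :
    LinearIndependent K
        (fun l : {l : List ι // l.Pairwise (· ≤ ·) ∧ (l.map d).sum = n} =>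
          shuffleList K (l.1.map f)) ∧
      Submodule.span K (Set.range
        (fun l : {l : List ι // l.Pairwise (· ≤ ·) ∧ (l.map d).sum = n} =>
          shuffleList K (l.1.map f))) = primOrth P X K n := by
  have hmem : ∀ i, f i ∈ ⨆ k ∈ Finset.Icc 1 (n - 1), primHomog P X K k := fun i => by
    rw [← hs]; exact Submodule.subset_span ⟨i, rfl⟩
  have hprim : ∀ i, f i ∈ prim P X K := fun i =>
    (iSup₂_le fun k _ => inf_le_left :
      (⨆ k ∈ Finset.Icc 1 (n - 1), primHomog P X K k) ≤ prim P X K) (hmem i)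
  have hdi : ∀ i, 1 ≤ d i ∧ d i ≤ n - 1 := by
    intro i
    have h1 : (⨆ k ∈ Finset.Icc 1 (n - 1), primHomog P X K k) ≤
        Finsupp.supported K K {m : Monomial P X | m.degree ∈ Finset.Icc 1 (n - 1)} := by
      refine iSup₂_le fun k hk => inf_le_right.trans (Finsupp.supported_mono fun m hm => ?_)
      rw [Set.mem_ofPred_eq] at hm ⊢
      rwa [hm]
    obtain ⟨T, hT⟩ := Finsupp.ne_iff.mp (hli.ne_zero i)
    have h2 : T.degree ∈ Finset.Icc 1 (n - 1) := by
      by_contra H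
      exact hT ((Finsupp.mem_supported' K _).mp (h1 (hmem i)) T H)
    rw [mem_homog.mp (hd i) T hT] at h2
    exact Finset.mem_Icc.mp h2
  set φ : MvPolynomial ι K →ₐ[K] ShuffleAlg P X K := aeval fun i => toShuffle (f i) with hφ
  have hinj : Function.Injective φ := aeval_injective (fun i => ⟨hprim i, hd i⟩) hli
  let e : {l : List ι // l.Pairwise (· ≤ ·) ∧ (l.map d).sum = n} → (ι →₀ ℕ) :=
    fun l => Multiset.toFinsupp (l.1 : Multiset ι)
  have he : Function.Injective e := by
    intro l l' h
    have h1 : (l.1 : Multiset ι) = l'.1 := Multiset.toFinsupp.injective h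
    exact Subtype.ext (List.Perm.eq_of_pairwise (fun a b _ _ h1 h2 => le_antisymm h1 h2)
      l.2.1 l'.2.1 (Multiset.coe_eq_coe.mp h1))
  have heq : (toShuffle.toLinearMap ∘ fun l : {l : List ι // l.Pairwise (· ≤ ·) ∧
      (l.map d).sum = n} => shuffleList K (l.1.map f)) =
      φ.toLinearMap ∘ (fun m : ι →₀ ℕ => monomial m (1 : K)) ∘ e :=
    funext fun l => toShuffle_shuffleList_map f l.1
  have hrange : Set.range e = {m | Finsupp.weight d m = n} := by
    ext m
    constructor
    · rintro ⟨l, rfl⟩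
      exact (weight_toFinsupp d l.1).trans l.2.2
    · intro hm
      have h1 : Multiset.toFinsupp ((Finsupp.toMultiset m).sort (· ≤ ·) : Multiset ι) = m := by
        rw [Multiset.sort_eq, Finsupp.toMultiset_toFinsupp]
      refine ⟨⟨(Finsupp.toMultiset m).sort (· ≤ ·), Multiset.pairwise_sort _ _, ?_⟩, h1⟩
      rw [← weight_toFinsupp, h1]
      exact hm
  have hspan : (Submodule.span K (Set.range
      (fun l : {l : List ι // l.Pairwise (· ≤ ·) ∧ (l.map d).sum = n} =>
        shuffleList K (l.1.map f)))).map toShuffle.toLinearMap =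
      (weightedHomogeneousSubmodule K d n).map φ.toLinearMap := by
    rw [Submodule.map_span, ← Set.range_comp, heq, Set.range_comp, Set.range_comp, hrange,
      weightedHomogeneousSubmodule_eq_span, Submodule.map_span]
  have hle : Submodule.span K (Set.range
      (fun l : {l : List ι // l.Pairwise (· ≤ ·) ∧ (l.map d).sum = n} =>
        shuffleList K (l.1.map f))) ≤ primOrth P X K n := by
    rw [Submodule.span_le]
    rintro _ ⟨⟨l, -, hl⟩, rfl⟩
    refine ⟨hl ▸ shuffleList_map_mem_homog hd l, fun w hw => ?_⟩
    -- The total degree `n ≥ 2` excludes the empty list, and degrees at most `n - 1` exclude a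
    -- single factor. With two factors or more the product is orthogonal to the primitives.
    match l, hl with
    | [], hl => simp at hl; omega
    | [i], hl =>
      have := hdi i
      simp at hl
      omega
    | i :: j :: l, hl =>
      have h1 := (hdi i).1
      have h2 := (hdi j).1
      refine pairing_prim_shuffle hw.1 (prim_apply_none (hprim i))
        (homog_apply_none (shuffleList_map_mem_homog hd (j :: l)) ?_)
      rw [List.map_cons, List.sum_cons]
      omega
  refine ⟨?_, le_antisymm hle fun b hb => ?_⟩
  · refine LinearIndependent.of_comp toShuffle.toLinearMap ?_
    rw [heq]
    exact ((linearIndependent_monomial ι).comp e he).map' _ (LinearMap.ker_eq_bot.mpr hinj)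
  · have hmon : ∀ T : Monomial P X, T.degree ≤ n - 1 → toShuffle (mon K T) ∈
        (weightedHomogeneousSubmodule K d (Multiset.cardHom T.content)).map φ.toLinearMap := by
      refine mon_mem_map (θ := Multiset.cardHom) fun T hT =>
        toShuffle_mem_map_of_mem_span (θ := Multiset.cardHom) hd (primPart_mem_primHomog T).2 ?_
      rw [hs]
      exact Submodule.mem_iSup_of_mem _ (Submodule.mem_iSup_of_mem
        (Finset.mem_Icc.mpr ⟨T.content_card_pos, hT⟩) (primPart_mem_primHomog T))
    have hT : ∀ T : PRTree P X, Multiset.card T.content = n → mon K (some T) - primPart K T ∈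
        Submodule.span K (Set.range
          (fun l : {l : List ι // l.Pairwise (· ≤ ·) ∧ (l.map d).sum = n} =>
            shuffleList K (l.1.map f))) := by
      intro T hT
      have h1 := decomp_mem_map hmon (by omega) (mon_sub_primPart_mem_decomp (K := K) T)
      rw [show Multiset.cardHom T.content = n from hT, ← hspan] at h1
      obtain ⟨x, hx, hx'⟩ := h1
      rwa [← toShuffle.injective hx']
    have hdeg : ∀ T ∈ b.support, T.degree = n := fun T hT =>
      mem_homog.mp hb.1 T (Finsupp.mem_support_iff.mp hT)
    -- This replaces every tree in `b` by its primitive part. The difference `b - u` lies in the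
    -- span, hence in the complement, so `u` is both primitive and orthogonal to the primitives.
    set u : FreeAlg P X K := b.sum fun T r => r • T.elim 0 (primPart K) with hu
    have hu1 : u ∈ primHomog P X K n := by
      refine sum_mem fun T hT' => Submodule.smul_mem _ _ ?_
      cases T with
      | none => exact zero_mem _
      | some T => rw [← hdeg _ hT']; exact primPart_mem_primHomog T
    have hbu : b - u ∈ Submodule.span K (Set.range
          (fun l : {l : List ι // l.Pairwise (· ≤ ·) ∧ (l.map d).sum = n} =>
            shuffleList K (l.1.map f))) := by
      have hb' : b = b.sum fun T r => r • mon K T := by simp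
      rw [hu]
      nth_rw 1 [hb']
      rw [← Finsupp.sum_sub]
      refine sum_mem fun T hT' => ?_
      change b T • mon K T - b T • T.elim 0 (primPart K) ∈ _
      rw [← smul_sub]
      refine Submodule.smul_mem _ _ ?_
      cases T with
      | none =>
        have := (degree_eq_zero_iff (none : Monomial P X)).mpr rfl
        have := hdeg _ hT'
        omega
      | some T => exact hT T (hdeg _ hT')
    have hu2 : u ∈ primOrth P X K n := by
      rw [← sub_sub_cancel b u]
      exact sub_mem hb (hle hbu)
    have hu0 : u = 0 := primHomog_eq_zero_of_pairing hu1 fun v hv => by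
      rw [pairing_comm]
      exact hu2.2 v hv
    rwa [hu0, sub_zero] at hbu

end Complement

/-! ## Dimensions of multihomogeneous components -/

section Dimension

open MvPolynomial

theorem finrank_span_image {V ι : Type*} [AddCommGroup V] [Module K V] {b : ι → V}
    (hb : LinearIndependent K b) (s : Set ι) :
    Module.finrank K (Submodule.span K (b '' s)) = Nat.card s := by
  have h : LinearIndependent K fun i : s => b i := hb.comp _ Subtype.val_injective
  rw [Set.image_eq_range]
  exact Module.finrank_eq_nat_card_basis (Module.Basis.span h)

theorem finite_of_finite_span_image {V ι : Type*} [AddCommGroup V] [Module K V] {b : ι → V}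
    (hb : LinearIndependent K b) (s : Set ι) [h : Module.Finite K (Submodule.span K (b '' s))] :
    Finite s := by
  have h2 : LinearIndependent K fun i : s => b i := hb.comp _ Subtype.val_injective
  rw [Set.image_eq_range] at h
  exact Module.Finite.finite_basis (Module.Basis.span h2)

theorem contentComp_eq_span (c : Multiset X) :
    contentComp P X K c = Submodule.span K ((fun T => mon K T) '' {m | m.content = c}) :=
  Finsupp.supported_eq_span_single K _

instance finite_contentComp (c : Multiset X) : Module.Finite K (contentComp P X K c) := by
  rw [contentComp_eq_span]
  exact FiniteDimensional.span_of_finite K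
    (((finite_content_le c).subset fun _ hT => le_of_eq hT).image _)

theorem linearIndependent_mon : LinearIndependent K fun T : Monomial P X => mon K T := by
  have := (Finsupp.basisSingleOne (R := K) (ι := Monomial P X)).linearIndependent
  rwa [Finsupp.coe_basisSingleOne] at this

theorem finrank_contentComp (c : Multiset X) :
    Module.finrank K (contentComp P X K c) = Nat.card {m : Monomial P X | m.content = c} := by
  rw [contentComp_eq_span]
  exact finrank_span_image (linearIndependent_mon (K := K) (P := P)) {m | m.content = c}

/-! ### Relabelling of leaves -/

variable {Y : Type*}

/-- Relabelling of the leaves of a tree. -/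
def PRTree.relabel (f : X → Y) : PRTree P X → PRTree P Y
  | .leaf x => .leaf (f x)
  | .node k hk c => .node k hk fun i => (c i).relabel f

theorem PRTree.content_relabel (f : X → Y) (T : PRTree P X) :
    (T.relabel f).content = T.content.map f := by
  induction T with
  | leaf x => simp [relabel, content]
  | node k hk c ih =>
    rw [relabel, content, content, ← Multiset.coe_mapAddMonoidHom, map_sum]
    exact Finset.sum_congr rfl fun i _ => ih i

theorem PRTree.relabel_injective {f : X → Y} (hf : Function.Injective f) :
    Function.Injective (PRTree.relabel (P := P) f) := by
  intro T
  induction T with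
  | leaf x =>
    intro T' h
    cases T' with
    | leaf y =>
      simp only [relabel, leaf.injEq] at h
      rw [hf h]
    | node => simp [relabel] at h
  | node k hk c ih =>
    intro T' h
    cases T' with
    | leaf y => simp [relabel] at h
    | node k' hk' c' =>
      simp only [relabel, node.injEq] at h
      obtain ⟨rfl, h⟩ := h
      rw [heq_eq_eq] at h
      congr 1
      funext i
      exact ih i (congrFun h i)

theorem PRTree.exists_relabel_eq (f : X → Y) (T : PRTree P Y)
    (hT : ∀ y ∈ T.content, y ∈ Set.range f) : ∃ T' : PRTree P X, T'.relabel f = T := by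
  induction T with
  | leaf y =>
    obtain ⟨x, rfl⟩ := hT y (by simp [content])
    exact ⟨.leaf x, rfl⟩
  | node k hk c ih =>
    have : ∀ i, ∃ T' : PRTree P X, T'.relabel f = c i := fun i => ih i fun y hy =>
      hT y (Multiset.mem_of_le (Finset.single_le_sum (f := fun i => (c i).content)
        (fun _ _ => Multiset.zero_le _) (Finset.mem_univ i)) hy)
    choose c' hc' using this
    exact ⟨.node k hk c', by simp [relabel, hc']⟩

theorem card_monomial_map (f : X → Y) (hf : Function.Injective f) (c : Multiset X) :
    Nat.card {m : Monomial P X | m.content = c} =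
      Nat.card {m : Monomial P Y | m.content = c.map f} := by
  have hcont : ∀ m : Monomial P X,
      Monomial.content (m.map (PRTree.relabel f)) = m.content.map f := by
    rintro (_ | T)
    · rfl
    · exact T.content_relabel f
  refine Nat.card_eq_of_bijective
    (fun m => ⟨m.1.map (PRTree.relabel f), by rw [Set.mem_ofPred_eq, hcont, m.2]⟩)
    ⟨fun m m' h => Subtype.ext ?_, ?_⟩
  · exact Option.map_injective (PRTree.relabel_injective hf) (congrArg Subtype.val h)
  · rintro ⟨m, hm⟩
    have : ∃ m' : Monomial P X, m'.map (PRTree.relabel f) = m := by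
      cases m with
      | none => exact ⟨none, rfl⟩
      | some T =>
        obtain ⟨T', rfl⟩ := T.exists_relabel_eq f fun y hy => by
          rw [show T.content = c.map f from hm] at hy
          obtain ⟨x, -, rfl⟩ := Multiset.mem_map.mp hy
          exact ⟨x, rfl⟩
        exact ⟨some T', rfl⟩
    obtain ⟨m', rfl⟩ := this
    refine ⟨⟨m', Multiset.map_injective hf ?_⟩, rfl⟩
    rw [← hcont]
    exact hm

variable (P K) in
/-- The dimension of the space of `n`-ary operations, including `1` for `n = 0`. -/
def treeDim (n : ℕ) : ℕ := Module.finrank K (contentComp P (Fin n) K Finset.univ.val)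

variable (P K) in
/-- The dimension of the space of primitive `n`-ary operations. -/
def primDim (n : ℕ) : ℕ :=
  Module.finrank K (prim P (Fin n) K ⊓ contentComp P (Fin n) K Finset.univ.val :
    Submodule K (FreeAlg P (Fin n) K))

/-- Enumerating `s` relabels the trees on `x₁, …, xₙ` bijectively, so the dimension depends only on
the number of labels. -/
theorem finrank_contentComp_finset (s : Finset X) :
    Module.finrank K (contentComp P X K s.val) = treeDim P K s.card := by
  let f : Fin s.card → X := fun i => s.equivFin.symm i
  have hf : Function.Injective f := Subtype.val_injective.comp s.equivFin.symm.injective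
  have hs : (Finset.univ.map ⟨f, hf⟩ : Finset X) = s := by
    ext x
    simp only [Finset.mem_map, Finset.mem_univ, true_and, Function.Embedding.coeFn_mk]
    exact ⟨fun ⟨i, hi⟩ => hi ▸ (s.equivFin.symm i).2,
      fun hx => ⟨s.equivFin ⟨x, hx⟩, by simp [f]⟩⟩
  rw [treeDim, finrank_contentComp, finrank_contentComp, card_monomial_map f hf]
  conv_lhs => rw [← hs]
  rfl

theorem treeDim_zero : treeDim P K 0 = 1 := by
  rw [treeDim, finrank_contentComp]
  have : {m : Monomial P (Fin 0) | m.content = Finset.univ.val} = {none} := by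
    ext m
    exact content_eq_zero_iff m
  rw [this, Nat.card_unique]

/-! ### Counting monomials in variables with a content -/

/-- In a product of content `insert x s` the label `x` occurs once, so exactly one factor contains
it, with multiplicity one. Its other labels form a subset `t` of `s`, and the remaining factors have
content `s \ t`. -/
theorem card_exponents_insert [DecidableEq X] {κ : Type*} (ct : κ → Multiset X)
    (h1 : ∀ c, Finite {i // ct i = c}) (h2 : ∀ c, Finite {m : κ →₀ ℕ // Finsupp.weight ct m = c})
    {x : X} {s : Finset X} (hx : x ∉ s) :
    Nat.card {m : κ →₀ ℕ // Finsupp.weight ct m = (insert x s).val} =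
      ∑ t ∈ s.powerset, Nat.card {i // ct i = (insert x t).val} *
        Nat.card {m : κ →₀ ℕ // Finsupp.weight ct m = (s \ t).val} := by
  classical
  have hval : ∀ t ∈ s.powerset, (insert x t).val + (s \ t).val = (insert x s).val := by
    intro t ht
    rw [Finset.mem_powerset] at ht
    have hxt : x ∉ t := fun h => hx (ht h)
    have h3 : Disjoint (insert x t) (s \ t) := by
      rw [Finset.disjoint_insert_left]
      exact ⟨fun h => hx (Finset.mem_sdiff.mp h).1, Finset.disjoint_sdiff⟩
    rw [← Finset.disjUnion_val _ _ h3, Finset.disjUnion_eq_union, Finset.insert_union,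
      Finset.union_sdiff_of_subset ht]
  have hle : ∀ (m : κ →₀ ℕ) i, m i ≠ 0 → ct i ≤ Finsupp.weight ct m := by
    intro m i hi
    have h3 : Finsupp.single i 1 ≤ m := Finsupp.single_le_iff.mpr (Nat.one_le_iff_ne_zero.mpr hi)
    rw [← tsub_add_cancel_of_le h3, map_add, Finsupp.weight_single, one_smul]
    exact Multiset.le_add_left _ _
  let Φ : (Σ t : s.powerset, {i // ct i = (insert x t.1).val} ×
      {m : κ →₀ ℕ // Finsupp.weight ct m = (s \ t.1).val}) →
      {m : κ →₀ ℕ // Finsupp.weight ct m = (insert x s).val} := fun q =>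
    ⟨Finsupp.single q.2.1.1 1 + q.2.2.1, by
      rw [map_add, Finsupp.weight_single, one_smul, q.2.1.2, q.2.2.2, hval _ q.1.2]⟩
  have hΦ : Function.Bijective Φ := by
    constructor
    · rintro ⟨⟨t, ht⟩, ⟨i, hi⟩, ⟨m, hm⟩⟩ ⟨⟨t', ht'⟩, ⟨j, hj⟩, ⟨m', hm'⟩⟩ h
      have h3 : Finsupp.single i 1 + m = Finsupp.single j 1 + m' := congrArg Subtype.val h
      rw [Finset.mem_powerset] at ht ht'
      -- If `i ≠ j`, then `i` would be a factor of `m'`, whose content avoids `x`, although `ct i`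
      -- contains `x`.
      obtain rfl : i = j := by
        by_contra hij
        have h4 := DFunLike.congr_fun h3 i
        rw [Finsupp.add_apply, Finsupp.add_apply, Finsupp.single_eq_same,
          Finsupp.single_eq_of_ne hij, zero_add] at h4
        have h5 := hle m' i (by omega)
        rw [hi, hm', Finset.val_le_iff] at h5
        exact hx (Finset.mem_sdiff.mp (h5 (Finset.mem_insert_self x t))).1
      obtain rfl : m = m' := add_left_cancel h3
      obtain rfl : t = t' := by
        have h6 : insert x t = insert x t' := Finset.val_injective (hi.symm.trans hj)
        rw [← Finset.erase_insert (fun h => hx (ht h)), h6,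
          Finset.erase_insert (fun h => hx (ht' h))]
      rfl
    · rintro ⟨m, hm⟩
      obtain ⟨i, hi, hxi⟩ : ∃ i, m i ≠ 0 ∧ x ∈ ct i := by
        have h3 : x ∈ Finsupp.weight ct m := by
          rw [hm]; exact Finset.mem_insert_self x s
        rw [Finsupp.weight_apply, Finsupp.sum, Multiset.mem_sum] at h3
        obtain ⟨i, hi, hxi⟩ := h3
        exact ⟨i, Finsupp.mem_support_iff.mp hi, Multiset.mem_of_mem_nsmul hxi⟩
      have h4 := hle m i hi
      rw [hm] at h4
      -- A multiset below a finset has no repetitions, so the content of the chosen factor is itself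
      -- a finset `u`, and `t` is `u` without `x`.
      have hnd : (ct i).Nodup := Multiset.nodup_of_le h4 (insert x s).nodup
      let u : Finset X := ⟨ct i, hnd⟩
      have hxu : x ∈ u := hxi
      have hus : u ⊆ insert x s := Finset.val_le_iff.mp h4
      have hts : u.erase x ∈ s.powerset := by
        rw [Finset.mem_powerset, ← Finset.subset_insert_iff]
        exact hus
      have hiu : ct i = (insert x (u.erase x)).val := by rw [Finset.insert_erase hxu]
      have h5 : Finsupp.single i 1 ≤ m :=
        Finsupp.single_le_iff.mpr (Nat.one_le_iff_ne_zero.mpr hi)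
      refine ⟨⟨⟨u.erase x, hts⟩, ⟨i, hiu⟩, ⟨m - Finsupp.single i 1, ?_⟩⟩, ?_⟩
      · have h6 : Finsupp.weight ct (Finsupp.single i 1 + (m - Finsupp.single i 1)) =
            (insert x s).val := by rw [add_tsub_cancel_of_le h5, hm]
        rw [map_add, Finsupp.weight_single, one_smul, hiu, ← hval _ hts] at h6
        exact add_left_cancel h6
      · exact Subtype.ext (add_tsub_cancel_of_le h5)
  rw [← Nat.card_eq_of_bijective Φ hΦ, Nat.card_sigma, ← Finset.sum_coe_sort s.powerset]
  exact Finset.sum_congr rfl fun t _ => Nat.card_prod _ _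

/-! ### Recursions for the dimensions of multilinear components -/

variable [CharZero K]

/-- The component of content `c` has as a basis the monomials of weight `c` in a content-homogeneous
basis of `Prim A`. The recursion is thus the count in `card_exponents_insert`. -/
theorem finrank_contentComp_insert [DecidableEq X] {x : X} {s : Finset X} (hx : x ∉ s) :
    Module.finrank K (contentComp P X K (insert x s).val) =
      ∑ t ∈ s.powerset, Module.finrank K (prim P X K ⊓ contentComp P X K (insert x t).val :
        Submodule K (FreeAlg P X K)) * Module.finrank K (contentComp P X K (s \ t).val) := by
  obtain ⟨κ, T, hli, hs⟩ := exists_basis_prim P X K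
  let ct : κ → Multiset X := fun i => (T i).content
  have hp : ∀ c, (prim P X K ⊓ contentComp P X K c : Submodule K (FreeAlg P X K)) =
      Submodule.span K ((fun i => primPart K (T i)) '' {i | ct i = c}) := by
    intro c
    refine le_antisymm (fun y hy => ?_) ?_
    · refine mem_span_image_of_mem_gradedComp (θ := AddMonoidHom.id _)
        (fun i => primPart_mem_contentComp (T i)) hy.2 ?_
      rw [hs]
      exact hy.1
    · rw [Submodule.span_le]
      rintro _ ⟨i, rfl, rfl⟩
      exact ⟨primPart_mem_prim _, primPart_mem_contentComp _⟩
  have hinj := (aeval_bijective hli hs).1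
  have ha : ∀ c, Nonempty (contentComp P X K c ≃ₗ[K]
      Submodule.span K ((fun m : κ →₀ ℕ => monomial m (1 : K)) ''
        {m | Finsupp.weight ct m = c})) := by
    intro c
    rw [← weightedHomogeneousSubmodule_eq_span]
    have e1 := Submodule.equivMapOfInjective
      (aeval (R := K) fun i => toShuffle (primPart K (T i))).toLinearMap hinj
      (weightedHomogeneousSubmodule K ct c)
    rw [gradedComp_eq_map_aeval hs] at e1
    exact ⟨(toShuffle.submoduleMap (contentComp P X K c)).trans e1.symm⟩
  have hpc : ∀ c, Module.finrank K (prim P X K ⊓ contentComp P X K c :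
      Submodule K (FreeAlg P X K)) = Nat.card {i // ct i = c} := by
    intro c
    rw [hp, finrank_span_image hli]
    rfl
  have hac : ∀ c, Module.finrank K (contentComp P X K c) =
      Nat.card {m : κ →₀ ℕ // Finsupp.weight ct m = c} := by
    intro c
    rw [(ha c).some.finrank_eq, finrank_span_image (linearIndependent_monomial κ)]
    rfl
  simp only [hpc, hac]
  refine card_exponents_insert ct (fun c => ?_) (fun c => ?_) hx
  · have : Module.Finite K (prim P X K ⊓ contentComp P X K c : Submodule K (FreeAlg P X K)) :=
      Submodule.finiteDimensional_inf_right _ _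
    rw [hp] at this
    exact finite_of_finite_span_image hli {i | ct i = c}
  · have := Module.Finite.equiv (ha c).some
    exact finite_of_finite_span_image (linearIndependent_monomial (K := K) κ)
      {m | Finsupp.weight ct m = c}

/-- The recursion determines these dimensions from those of the tree spaces, which depend only on
the number of labels; so no transport of primitive elements along a relabelling is needed. -/
theorem finrank_prim_contentComp (n : ℕ) {X Y : Type} (s : Finset X) (t : Finset Y)
    (hs : s.card = n + 1) (ht : t.card = n + 1) :
    Module.finrank K (prim P X K ⊓ contentComp P X K s.val : Submodule K (FreeAlg P X K)) =
      Module.finrank K (prim P Y K ⊓ contentComp P Y K t.val : Submodule K (FreeAlg P Y K)) := by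
  classical
  induction n using Nat.strong_induction_on generalizing X Y with
  | _ n ih =>
  -- The term where the distinguished factor takes all labels is the unknown, its cofactor being
  -- `treeDim P K 0 = 1`. It is split off, and the `if` removes it from the sum; all other terms are
  -- covered by induction.
  have key : ∀ (Z : Type) (r : Finset Z), r.card = n + 1 → treeDim P K (n + 1) =
      Module.finrank K (prim P Z K ⊓ contentComp P Z K r.val : Submodule K (FreeAlg P Z K)) +
        ∑ m ∈ Finset.range (n + 1), n.choose m •
          if m = n then 0 else primDim P K (m + 1) * treeDim P K (n - m) := by
    intro Z r hr
    obtain ⟨z, r', hz, rfl, hr'⟩ := Finset.card_eq_succ.mp hr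
    rw [← hr, ← finrank_contentComp_finset, finrank_contentComp_insert hz, hr]
    subst hr'
    rw [← Finset.sum_powerset_apply_card fun m =>
      if m = r'.card then 0 else primDim P K (m + 1) * treeDim P K (r'.card - m)]
    rw [← Finset.add_sum_erase _ _ (Finset.mem_powerset_self r'),
      ← Finset.add_sum_erase (a := r') r'.powerset (fun m => ite _ _ _)
        (Finset.mem_powerset_self r'), if_pos rfl, zero_add, sdiff_self,
      finrank_contentComp_finset, Finset.bot_eq_empty, Finset.card_empty, treeDim_zero, mul_one]
    congr 1
    refine Finset.sum_congr rfl fun u hu => ?_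
    rw [Finset.mem_erase, Finset.mem_powerset] at hu
    have hlt : u.card < r'.card := Finset.card_lt_card (hu.2.ssubset_of_ne hu.1)
    rw [if_neg hlt.ne, finrank_contentComp_finset, Finset.card_sdiff_of_subset hu.2]
    congr 1
    exact ih u.card hlt _ Finset.univ
      (Finset.card_insert_of_notMem fun h => hz (hu.2 h)) (Finset.card_fin _)
  exact Nat.add_right_cancel ((key X s hs).symm.trans (key Y t ht))

theorem treeDim_succ (n : ℕ) : treeDim P K (n + 1) =
    ∑ m ∈ Finset.range (n + 1), n.choose m * (primDim P K (m + 1) * treeDim P K (n - m)) := by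
  classical
  obtain ⟨z, r, hz, hr, hr'⟩ := Finset.card_eq_succ.mp (Finset.card_fin (n + 1))
  have h1 : treeDim P K (n + 1) = Module.finrank K (contentComp P (Fin (n + 1)) K
    (insert z r).val) := by rw [hr]; rfl
  rw [h1, finrank_contentComp_insert hz]
  have h2 := Finset.sum_powerset_apply_card
    (fun m => primDim P K (m + 1) * treeDim P K (n - m)) (x := r)
  simp only [smul_eq_mul, hr'] at h2
  rw [← h2]
  refine Finset.sum_congr rfl fun u hu => ?_
  rw [Finset.mem_powerset] at hu
  rw [finrank_contentComp_finset, Finset.card_sdiff_of_subset hu, hr']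
  congr 1
  exact finrank_prim_contentComp u.card _ Finset.univ
    (Finset.card_insert_of_notMem fun h => hz (hu h)) (Finset.card_fin _)

end Dimension

/-! ## The generating series -/

section Series

open PowerSeries

/-- Both series have zero constant term, and both have derivative `F' / F`. -/
theorem eq_logOf_of_derivative {F G : ℚ⟦X⟧} (hF : constantCoeff F = 1)
    (hG : constantCoeff G = 0) (h : d⁄dX ℚ F = d⁄dX ℚ G * F) : G = logOf F := by
  have hsub : HasSubst (F - 1) := HasSubst.of_constantCoeff_zero' (by simp [hF])
  refine derivative.ext ?_ (by rw [hG, constantCoeff_logOf hF])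
  -- The series `log ℚ` is that of `log (1 + X)`, with derivative `1 / (1 + X)`; hence the
  -- substitution of `F - 1` below.
  have h1 : (d⁄dX ℚ (log ℚ)) * (1 + X) = 1 := by
    rw [deriv_log, mul_add, mul_one]
    ext n
    cases n with
    | zero => simp
    | succ n => simp [coeff_succ_mul_X, pow_succ, coeff_one]
  have h2 : (d⁄dX ℚ (log ℚ)).subst (F - 1) * F = 1 := by
    have h3 := congrArg (subst (F - 1)) h1
    rw [subst_mul hsub, subst_add hsub, subst_X hsub, ← coe_substAlgHom hsub, map_one] at h3
    rw [coe_substAlgHom] at h3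
    simpa using h3
  have h4 : d⁄dX ℚ (F - 1) = d⁄dX ℚ F := by rw [map_sub, derivative_one, sub_zero]
  rw [logOf_eq, derivative_subst hsub, h4, h, mul_comm (d⁄dX ℚ G), ← mul_assoc, h2, one_mul]

end Series

/-- Divided by `n!`, the binomial recursion is the coefficient of `tⁿ` in `F' = G' F`. The summand
`1` restores the term `a 0` that `genSeries` omits. -/
theorem genSeries_eq_logOf {a p : ℕ → ℕ} (h0 : a 0 = 1)
    (h : ∀ n, a (n + 1) = ∑ m ∈ Finset.range (n + 1), n.choose m * (p (m + 1) * a (n - m))) :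
    genSeries p = PowerSeries.logOf (1 + genSeries a) := by
  refine eq_logOf_of_derivative ?_ ?_ ?_
  · simp [genSeries]
  · simp [genSeries]
  · have h1 : ∀ n, PowerSeries.coeff n (1 + genSeries a) = (a n : ℚ) / n.factorial := by
      intro n
      rw [map_add, PowerSeries.coeff_one, genSeries, PowerSeries.coeff_mk]
      split_ifs with hn
      · simp [hn, h0]
      · rw [zero_add]
    ext n
    rw [PowerSeries.coeff_derivative, h1, PowerSeries.coeff_mul,
      Finset.Nat.sum_antidiagonal_eq_sum_range_succ_mk, h, Nat.cast_sum, Finset.sum_div,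
      Finset.sum_mul]
    refine Finset.sum_congr rfl fun m hm => ?_
    have hmn : m ≤ n := Nat.lt_succ_iff.mp (Finset.mem_range.mp hm)
    rw [PowerSeries.coeff_derivative, h1, genSeries, PowerSeries.coeff_mk, if_neg m.succ_ne_zero]
    push_cast [Nat.cast_choose ℚ hmn, Nat.factorial_succ]
    have e1 : (n.factorial : ℚ) ≠ 0 := by exact_mod_cast n.factorial_ne_zero
    have e2 : (m.factorial : ℚ) ≠ 0 := by exact_mod_cast m.factorial_ne_zero
    have e3 : ((n - m).factorial : ℚ) ≠ 0 := by exact_mod_cast (n - m).factorial_ne_zero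
    have e4 : (n : ℚ) + 1 ≠ 0 := by positivity
    have e5 : (m : ℚ) + 1 ≠ 0 := by positivity
    field_simp

/-- For `n = 0` the two differ, since the empty tree has empty content but is not an operation. The
generating series ignores that term. -/
theorem operadSpace_eq {n : ℕ} (hn : n ≠ 0) :
    operadSpace P K n = contentComp P (Fin n) K Finset.univ.val := by
  rw [operadSpace, contentComp]
  congr 1
  ext m
  constructor
  · rintro ⟨T, rfl, hT⟩
    exact hT
  · intro hm
    cases m with
    | none =>
      have h1 : Multiset.card (Finset.univ : Finset (Fin n)).val = n := Finset.card_fin n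
      rw [← show Monomial.content (none : Monomial P (Fin n)) = _ from hm] at h1
      exact absurd h1.symm hn
    | some T => exact ⟨T, rfl, hm⟩

theorem operadSpace_le (n : ℕ) :
    operadSpace P K n ≤ contentComp P (Fin n) K Finset.univ.val := by
  refine Finsupp.supported_mono ?_
  rintro _ ⟨T, rfl, hT⟩
  exact hT

theorem finite_operadSpace (n : ℕ) : Module.Finite K (operadSpace P K n) :=
  Submodule.finiteDimensional_of_le (operadSpace_le n)

theorem finite_primOperadSpace (n : ℕ) : Module.Finite K (primOperadSpace P K n) :=
  Submodule.finiteDimensional_of_le (inf_le_left.trans (operadSpace_le n))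

variable (P K) in
theorem genSeries_primOperadSpace [CharZero K] :
    genSeries (fun n => Module.finrank K (primOperadSpace P K n)) =
      PowerSeries.logOf (1 + genSeries fun n => Module.finrank K (operadSpace P K n)) := by
  have h1 : genSeries (fun n => Module.finrank K (operadSpace P K n)) =
      genSeries (treeDim P K) := by
    ext n
    rw [genSeries, genSeries, PowerSeries.coeff_mk, PowerSeries.coeff_mk]
    split_ifs with hn
    · rfl
    · rw [operadSpace_eq hn]; rfl
  have h2 : genSeries (fun n => Module.finrank K (primOperadSpace P K n)) =
      genSeries (primDim P K) := by
    ext n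
    rw [genSeries, genSeries, PowerSeries.coeff_mk, PowerSeries.coeff_mk]
    split_ifs with hn
    · rfl
    · rw [primOperadSpace, operadSpace_eq hn, inf_comm]; rfl
  rw [h1, h2]
  exact genSeries_eq_logOf treeDim_zero treeDim_succ

end MagPBW

end


open MagPBW

theorem mainTheorem1 (K : Type*) [Field K] [CharZero K] (P : Kind) (X : Type*) :
    -- the space of primitive elements is graded
    (prim P X K = ⨆ n : ℕ, primHomog P X K n) ∧
    -- (i) the unitary commutative algebra `(A, ⧢)` is freely generated by `Prim A`
    (∃ φ : SymmetricAlgebra K (prim P X K) ≃ₗ[K] FreeAlg P X K,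
      φ 1 = unit K ∧
      (∀ a b, φ (a * b) = shuffle P X K (φ a) (φ b)) ∧
      ∀ w : prim P X K, φ (SymmetricAlgebra.ι K (prim P X K) w) = (w : FreeAlg P X K)) ∧
    -- (ii) the generating series of the operad of primitives is the logarithm
    ((∀ n : ℕ, Module.Finite K (operadSpace P K n) ∧ Module.Finite K (primOperadSpace P K n)) ∧
      genSeries (fun n => Module.finrank K (primOperadSpace P K n)) =
        PowerSeries.logOf (1 + genSeries fun n => Module.finrank K (operadSpace P K n))) ∧
    -- (iii) bases of the orthogonal complements
    (∀ n : ℕ, 2 ≤ n → ∀ (ι : Type*) [LinearOrder ι] (f : ι → FreeAlg P X K) (d : ι → ℕ),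
      (∀ i, f i ∈ homog P X K (d i)) →
      LinearIndependent K f →
      Submodule.span K (Set.range f) = (⨆ k ∈ Finset.Icc 1 (n - 1), primHomog P X K k) →
      LinearIndependent K
          (fun l : {l : List ι // l.Pairwise (· ≤ ·) ∧ (l.map d).sum = n} =>
            shuffleList K (l.1.map f)) ∧
        Submodule.span K (Set.range
          (fun l : {l : List ι // l.Pairwise (· ≤ ·) ∧ (l.map d).sum = n} =>
            shuffleList K (l.1.map f))) = primOrth P X K n) := by
  exact ⟨prim_eq_iSup, exists_symmetricAlgebra_equiv P X K,
    ⟨fun n => ⟨finite_operadSpace n, finite_primOperadSpace n⟩, genSeries_primOperadSpace P K⟩,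
    fun _ hn _ _ f d hd hli hs => sorted_shuffleList_basis hn f d hd hli hs⟩
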